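/- Let $\mathcal C$ be a semi-abelian category (pointed, with finite coproducts, Barr-exact and protomodular) in which the implication "Huq $\Rightarrow$ Smith" holds: two equivalence relations on the same object commute in the sense of Smith whenever their normalizations commute in the sense of Huq. Composites are written in diagrammatic order. For objects $B,X$ let $j\colon B\flat X\to B+X$ be the kernel of $[1,0]\colon B+X\to B$, and let $\chi_X=j\cdot[1,1]\colon X\flat X\to X$ be the conjugation; a $B$-action on $X$ is an algebra $\xi\colon B\flat X\to X$ for the monad $B\flat(-)$. A crossed module $\mathbb G$ is a morphism $\partial\colon G\to G_0$ with an action $\xi\colon G_0\flat G\to G$ such that $(\partial\flat 1)\cdot\xi=\chi_G$ and $\xi\cdot\partial=(1\flat\partial)\cdot\chi_{G_0}$. A butterfly $E\colon\mathbb H\to\mathbb G$ consists of an object $E$ and morphisms $\kappa\colon H\to E$, $\iota\colon G\to E$, $\sigma\colon E\to H_0$, $\rho\colon E\to G_0$ with $\kappa\sigma=\partial$, $\iota\rho=\partial$, $\kappa\rho=0$, $\iota=\ker\sigma$, $\sigma=\operatorname{coker}\iota$, $(\sigma\flat1)\cdot\xi\cdot\kappa=(1\flat\kappa)\cdot\chi_E$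 and $(\rho\flat1)\cdot\xi\cdot\iota=(1\flat\iota)\cdot\chi_E$. A morphism of butterflies $E\to E'$ is a morphism $f\colon E\to E'$ of $\mathcal C$ with $\kappa f=\kappa'$, $\iota f=\iota'$, $f\sigma'=\sigma$, $f\rho'=\rho$. Then every morphism of butterflies is an isomorphism, and there is a bicategory $\mathcal B(\mathcal C)$ whose objects are the crossed modules in $\mathcal C$, whose 1-cells are the butterflies and whose 2-cells are the morphisms of butterflies, with vertical composition that of $\mathcal C$, such that: 1. The composite of $E\colon\mathbb H\to\mathbb G$ and $E'\colon\mathbb G\to\mathbb K$ is the butterfly with object the cokernel $q\colon E\times_{\rho,\sigma'}E'\to Q$ of $\langle\iota,\kappa'\rangle\colon G\to E\times_{\rho,\sigma'}E'$, and with legs $\langle\kappa,0\rangle q\colon H\to Q$, $\langle 0,\iota'\rangle q\colon K\to Q$ and the morphisms $Q\to H_0$, $Q\to K_0$ induced by $r\sigma$ and $s\rho'$, where $r,s$ are the pullback projections. Horizontal composition of 2-cells is induced by the universal properties of pullback and cokernel. 2. The identity of $\mathbb G$ is the butterfly with object $G_1=G\rtimes_\xi G_0$ and $\kappa=g\cdot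 i$, $\iota=g$, $\sigma=c$, $\rho=d$. Here $[e,g]\colon G_0+G\to G_1$ is the coequalizer of $j$ and $\xi\cdot i_G$, the morphisms $d,c\colon G_1\to G_0$ satisfy $ed=ec=1$, $gd=\partial$, $gc=0$, and $i\colon G_1\to G_1$ is the inverse map of an internal groupoid structure on the reflexive graph $(d,c,e)$. 3. The associators and unitors are the canonical ones. Writing $[x,y]=\langle x,y\rangle q$ for generalized elements of a composite, they are the 2-cells with $[[x,y],z]\mapsto[x,[y,z]]$, $[e(\sigma(x)),x]\mapsto x$ and $[x,e(\rho(x))]\mapsto x$. -/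

import Mathlib

open CategoryTheory CategoryTheory.Limits

universe u v

namespace SemiAb

/-! ### Semi-abelian categories and the condition "Huq = Smith" -/

/-- `k` is a kernel of `p`. -/
def IsKernel {C : Type u} [Category.{v} C] [HasZeroMorphisms C] {K A B : C}
    (k : K ⟶ A) (p : A ⟶ B) : Prop :=
  ∃ w : k ≫ p = 0, Nonempty (IsLimit (KernelFork.ofι k w))

/-- `q` is a cokernel of `f`. -/
def IsCokernel {C : Type u} [Category.{v} C] [HasZeroMorphisms C] {A B Q : C}
    (f : A ⟶ B) (q : B ⟶ Q) : Prop :=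
  ∃ w : f ≫ q = 0, Nonempty (IsColimit (CokernelCofork.ofπ q w))

/-- A semi-abelian category: pointed, with finite coproducts, (Barr-)exact and protomodular.
Exact means regular (in particular finitely complete) with every internal equivalence relation a
kernel pair; protomodularity of a pointed finitely complete category is the split short five
lemma. -/
class SemiAbelian (C : Type u) [Category.{v} C] [HasZeroMorphisms C] : Prop
    extends Regular C where
  hasFiniteCoproducts : HasFiniteCoproducts C
  hasZeroObject : HasZeroObject C
  effective : ∀ {R X : C} (p₁ p₂ : R ⟶ X), IsEquivalenceRelation p₁ p₂ →
    ∃ (Y : C) (f : X ⟶ Y), IsKernelPair f p₁ p₂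
  split_short_five : ∀ {K A B K' A' B' : C}
    (k : K ⟶ A) (p : A ⟶ B) (s : B ⟶ A) (k' : K' ⟶ A') (p' : A' ⟶ B') (s' : B' ⟶ A')
    (h : K ⟶ K') (f : A ⟶ A') (g : B ⟶ B'),
    IsKernel k p → s ≫ p = 𝟙 B → IsKernel k' p' → s' ≫ p' = 𝟙 B' →
    k ≫ f = h ≫ k' → p ≫ g = f ≫ p' → s ≫ f = g ≫ s' →
    IsIso h → IsIso g → IsIso f

attribute [instance] SemiAbelian.hasFiniteCoproducts SemiAbelian.hasZeroObject

/-- Two morphisms with the same codomain commute in the sense of Huq (they cooperate). -/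
def HuqCommute {C : Type u} [Category.{v} C] [HasZeroMorphisms C] [HasFiniteLimits C]
    {X Y E : C} (x : X ⟶ E) (y : Y ⟶ E) : Prop :=
  ∃ φ : X ⨯ Y ⟶ E, prod.lift (𝟙 X) 0 ≫ φ = x ∧ prod.lift 0 (𝟙 Y) ≫ φ = y

/-- Two equivalence relations `(r₀, r₁)` and `(s₀, s₁)` on `E` commute in the sense of Smith:
there is `Φ`, defined on the triples `x R y S z`, with `Φ(x, y, y) = x` and `Φ(y, y, z) = z`. -/
def SmithCommute {C : Type u} [Category.{v} C] [HasFiniteLimits C] {R S E : C}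
    {r₀ r₁ : R ⟶ E} (hR : EquivalenceRelation r₀ r₁)
    {s₀ s₁ : S ⟶ E} (hS : EquivalenceRelation s₀ s₁) : Prop :=
  ∃ Φ : pullback r₁ s₀ ⟶ E,
    pullback.lift (𝟙 R) (r₁ ≫ hS.r)
      (by rw [Category.assoc, hS.reflexivity₁, Category.id_comp, Category.comp_id]) ≫ Φ = r₀ ∧
    pullback.lift (s₀ ≫ hR.r) (𝟙 S)
      (by rw [Category.assoc, hR.reflexivity₂, Category.id_comp, Category.comp_id]) ≫ Φ = s₁

/-- The implication "Huq ⇒ Smith": two equivalence relations on the same object commute in the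
sense of Smith as soon as their normalizations (zero-classes) commute in the sense of Huq. -/
def HuqImpliesSmith (C : Type u) [Category.{v} C] [HasZeroMorphisms C] [HasFiniteLimits C] :
    Prop :=
  ∀ {R S E : C} {r₀ r₁ : R ⟶ E} (hR : EquivalenceRelation r₀ r₁)
    {s₀ s₁ : S ⟶ E} (hS : EquivalenceRelation s₀ s₁),
    HuqCommute (kernel.ι r₁ ≫ r₀) (kernel.ι s₁ ≫ s₀) → SmithCommute hR hS

/-! ### Internal actions -/

section Actions

variable {C : Type u} [Category.{v} C] [HasZeroMorphisms C] [HasFiniteLimits C]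
  [HasFiniteCoproducts C]

/-- The object `B ♭ X`, kernel of `[1, 0] : B + X ⟶ B`. -/
noncomputable def flat (B X : C) : C := kernel (coprod.desc (𝟙 B) (0 : X ⟶ B))

/-- The canonical inclusion `B ♭ X ⟶ B + X`. -/
noncomputable def flatι (B X : C) : flat B X ⟶ B ⨿ X :=
  kernel.ι (coprod.desc (𝟙 B) (0 : X ⟶ B))

theorem flatι_desc (B X : C) : flatι B X ≫ coprod.desc (𝟙 B) (0 : X ⟶ B) = 0 :=
  kernel.condition _

/-- The morphism into `B ♭ X` induced by the universal property of the kernel. -/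
noncomputable def flatLift {B X T : C} (t : T ⟶ B ⨿ X)
    (h : t ≫ coprod.desc (𝟙 B) (0 : X ⟶ B) = 0) : T ⟶ flat B X :=
  kernel.lift _ t h

/-- `f ♭ g : B ♭ X ⟶ B' ♭ X'`, the restriction of `f + g`. -/
noncomputable def flatMap {B B' X X' : C} (f : B ⟶ B') (g : X ⟶ X') : flat B X ⟶ flat B' X' :=
  flatLift (flatι B X ≫ coprod.map f g) (by
    have h : coprod.map f g ≫ coprod.desc (𝟙 B') (0 : X' ⟶ B') =
        coprod.desc (𝟙 B) (0 : X ⟶ B) ≫ f := by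
      ext <;> simp
    rw [Category.assoc, h, ← Category.assoc, flatι_desc, zero_comp])

/-- The unit of the monad `B ♭ (-)`, the restriction of the injection `X ⟶ B + X`. -/
noncomputable def flatUnit (B X : C) : X ⟶ flat B X :=
  flatLift coprod.inr (coprod.inr_desc _ _)

/-- The multiplication of the monad `B ♭ (-)`, the restriction of
`[i_B, j] : B + (B ♭ X) ⟶ B + X`. -/
noncomputable def flatMul (B X : C) : flat B (flat B X) ⟶ flat B X :=
  flatLift (flatι B (flat B X) ≫ coprod.desc coprod.inl (flatι B X)) (by
    have h : coprod.desc coprod.inl (flatι B X) ≫ coprod.desc (𝟙 B) (0 : X ⟶ B) =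
        coprod.desc (𝟙 B) (0 : flat B X ⟶ B) := by
      apply coprod.hom_ext
      · rw [coprod.inl_desc_assoc, coprod.inl_desc, coprod.inl_desc]
      · rw [coprod.inr_desc_assoc, flatι_desc, coprod.inr_desc]
    rw [Category.assoc, h, flatι_desc])

/-- The conjugation `χ_X : X ♭ X ⟶ X`. -/
noncomputable def conj (X : C) : flat X X ⟶ X := flatι X X ≫ coprod.desc (𝟙 X) (𝟙 X)

/-- An internal action of `B` on `X`: an algebra structure on `X` for the monad `B ♭ (-)`. -/
structure InternalAction (B X : C) where
  act : flat B X ⟶ X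
  unit_act : flatUnit B X ≫ act = 𝟙 X
  mul_act : flatMul B X ≫ act = flatMap (𝟙 B) act ≫ act

end Actions

/-! ### Internal groupoids -/

/-- An internal groupoid structure on the graph `d, c : G₁ ⟶ G₀` with unit `e`. Composition is
written in diagrammatic order: `m (f, g)` is defined when the codomain of `f` is the domain
of `g`. -/
structure InternalGroupoid {C : Type u} [Category.{v} C] [HasFiniteLimits C] {G₁ G₀ : C}
    (d c : G₁ ⟶ G₀) (e : G₀ ⟶ G₁) where
  e_d : e ≫ d = 𝟙 G₀
  e_c : e ≫ c = 𝟙 G₀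
  m : pullback c d ⟶ G₁
  m_d : m ≫ d = pullback.fst c d ≫ d
  m_c : m ≫ c = pullback.snd c d ≫ c
  id_m : pullback.lift (d ≫ e) (𝟙 G₁) (by simp [e_c]) ≫ m = 𝟙 G₁
  m_id : pullback.lift (𝟙 G₁) (c ≫ e) (by simp [e_d]) ≫ m = 𝟙 G₁
  m_assoc : ∀ {T : C} (x y z : T ⟶ G₁) (hxy : x ≫ c = y ≫ d) (hyz : y ≫ c = z ≫ d),
    pullback.lift (pullback.lift x y hxy ≫ m) z
      (by rw [Category.assoc, m_c, pullback.lift_snd_assoc, hyz]) ≫ m =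
    pullback.lift x (pullback.lift y z hyz ≫ m)
      (by rw [Category.assoc, m_d, pullback.lift_fst_assoc, hxy]) ≫ m
  inv : G₁ ⟶ G₁
  inv_d : inv ≫ d = c
  inv_c : inv ≫ c = d
  m_inv : pullback.lift (𝟙 G₁) inv (by rw [Category.id_comp, inv_d]) ≫ m = d ≫ e
  inv_m : pullback.lift inv (𝟙 G₁) (by rw [Category.id_comp, inv_c]) ≫ m = c ≫ e

/-! ### Crossed modules and butterflies -/

/-- An internal crossed module `∂ : top ⟶ base`. -/
structure CrossedModule (C : Type u) [Category.{v} C] [HasZeroMorphisms C] [HasFiniteLimits C]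
    [HasFiniteCoproducts C] where
  top : C
  base : C
  bd : top ⟶ base
  action : InternalAction base top
  peiffer : flatMap bd (𝟙 top) ≫ action.act = conj top
  precrossed : action.act ≫ bd = flatMap (𝟙 base) bd ≫ conj base

section Butterflies

variable {C : Type u} [Category.{v} C] [HasZeroMorphisms C] [HasFiniteLimits C]
  [HasFiniteCoproducts C]

/-- A butterfly from the crossed module `H` to the crossed module `G`. -/
structure Butterfly (H G : CrossedModule C) where
  E : C
  κ : H.top ⟶ E
  ι : G.top ⟶ E
  σ : E ⟶ H.base
  ρ : E ⟶ G.base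
  κ_σ : κ ≫ σ = H.bd
  ι_ρ : ι ≫ ρ = G.bd
  κ_ρ : κ ≫ ρ = 0
  isKernel : IsKernel ι σ
  isCokernel : IsCokernel ι σ
  κ_equivariant :
    flatMap σ (𝟙 H.top) ≫ H.action.act ≫ κ = flatMap (𝟙 E) κ ≫ conj E
  ι_equivariant :
    flatMap ρ (𝟙 G.top) ≫ G.action.act ≫ ι = flatMap (𝟙 E) ι ≫ conj E

/-- A morphism of butterflies. -/
@[ext]
structure Butterfly.Hom {H G : CrossedModule C} (E E' : Butterfly H G) where
  hom : E.E ⟶ E'.E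
  κ_hom : E.κ ≫ hom = E'.κ
  ι_hom : E.ι ≫ hom = E'.ι
  hom_σ : hom ≫ E'.σ = E.σ
  hom_ρ : hom ≫ E'.ρ = E.ρ

/-- The category of butterflies from `H` to `G`. -/
instance Butterfly.category (H G : CrossedModule C) : Category.{v} (Butterfly H G) where
  Hom E E' := Butterfly.Hom E E'
  id E := ⟨𝟙 E.E, by simp, by simp, by simp, by simp⟩
  comp f g := ⟨f.hom ≫ g.hom,
    by rw [← Category.assoc, f.κ_hom, g.κ_hom],
    by rw [← Category.assoc, f.ι_hom, g.ι_hom],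
    by rw [Category.assoc, g.hom_σ, f.hom_σ],
    by rw [Category.assoc, g.hom_ρ, f.hom_ρ]⟩
  id_comp f := by apply Butterfly.Hom.ext; simp
  comp_id f := by apply Butterfly.Hom.ext; simp
  assoc f g h := by apply Butterfly.Hom.ext; simp

/-- `Comp E E' F` exhibits `F` as the composite of the butterflies `E` and `E'`: the object of `F`
is the cokernel `q` of `⟨ι, κ'⟩ : G ⟶ E ×_{G₀} E'`, the pullback being that of `ρ` and `σ'`, and
the four legs of `F` are the induced morphisms. -/
structure Comp {H G K : CrossedModule C} (E : Butterfly H G) (E' : Butterfly G K)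
    (F : Butterfly H K) where
  q : pullback E.ρ E'.σ ⟶ F.E
  isCokernel : IsCokernel (pullback.lift E.ι E'.κ (by rw [E.ι_ρ, E'.κ_σ])) q
  κ_eq : F.κ = pullback.lift E.κ 0 (by rw [E.κ_ρ, zero_comp]) ≫ q
  ι_eq : F.ι = pullback.lift 0 E'.ι (by rw [E'.isKernel.choose, zero_comp]) ≫ q
  q_σ : q ≫ F.σ = pullback.fst E.ρ E'.σ ≫ E.σ
  q_ρ : q ≫ F.ρ = pullback.snd E.ρ E'.σ ≫ E'.ρ

/-- The (generalized) element `[x, y]` of a composite of butterflies, that is, the class of the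
element `(x, y)` of the pullback. -/
noncomputable def Comp.pair {H G K : CrossedModule C} {E : Butterfly H G} {E' : Butterfly G K}
    {F : Butterfly H K} (D : Comp E E' F) {T : C} (x : T ⟶ E.E) (y : T ⟶ E'.E)
    (h : x ≫ E.ρ = y ≫ E'.σ) : T ⟶ F.E :=
  pullback.lift x y h ≫ D.q

theorem Comp.pair_σ {H G K : CrossedModule C} {E : Butterfly H G} {E' : Butterfly G K}
    {F : Butterfly H K} (D : Comp E E' F) {T : C} (x : T ⟶ E.E) (y : T ⟶ E'.E)
    (h : x ≫ E.ρ = y ≫ E'.σ) : D.pair x y h ≫ F.σ = x ≫ E.σ := by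
  rw [Comp.pair, Category.assoc, D.q_σ, pullback.lift_fst_assoc]

theorem Comp.pair_ρ {H G K : CrossedModule C} {E : Butterfly H G} {E' : Butterfly G K}
    {F : Butterfly H K} (D : Comp E E' F) {T : C} (x : T ⟶ E.E) (y : T ⟶ E'.E)
    (h : x ≫ E.ρ = y ≫ E'.σ) : D.pair x y h ≫ F.ρ = y ≫ E'.ρ := by
  rw [Comp.pair, Category.assoc, D.q_ρ, pullback.lift_snd_assoc]

/-- `Ident I` exhibits `I` as the canonical butterfly of the crossed module `G`. Its object
`G₁ = G ⋊ G₀` is the semidirect product, i.e. the coequalizer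
`[e, g] : G₀ + G ⟶ G₁` of `j : G₀ ♭ G ⟶ G₀ + G` and `ξ ≫ i_G`; the arrows `d = I.ρ`, `c = I.σ`
and `e` make `G₁` the groupoid of `G`: `e ≫ d = e ≫ c = 1`, `g ≫ d = ∂`, `g ≫ c = 0` (the last
two are part of `I` being a butterfly); and `I.ι = g`, `I.κ = g ≫ i` with `i` the inverse map of
the groupoid. -/
structure Ident {G : CrossedModule C} (I : Butterfly G G) where
  e : G.base ⟶ I.E
  w : flatι G.base G.top ≫ coprod.desc e I.ι =
    (G.action.act ≫ coprod.inr) ≫ coprod.desc e I.ι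
  isCoequalizer : Nonempty (IsColimit (Cofork.ofπ (coprod.desc e I.ι) w))
  groupoid : InternalGroupoid I.ρ I.σ e
  κ_eq : I.κ = I.ι ≫ groupoid.inv

end Butterflies

/-! ### Bicategories with prescribed hom-categories -/

/-- A bicategory with objects `O` and prescribed hom-categories `Hom a b`. The fields are those of
Mathlib's `Bicategory`, see `BicategoryOn.toBicategory`. -/
structure BicategoryOn {O : Type*} (Hom : O → O → Type*) [∀ a b, Category (Hom a b)] where
  one : ∀ a, Hom a a
  comp : ∀ {a b c}, Hom a b → Hom b c → Hom a c
  whiskerLeft : ∀ {a b c} (f : Hom a b) {g h : Hom b c}, (g ⟶ h) → (comp f g ⟶ comp f h)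
  whiskerRight : ∀ {a b c} {f g : Hom a b}, (f ⟶ g) → ∀ h : Hom b c, comp f h ⟶ comp g h
  associator : ∀ {a b c d} (f : Hom a b) (g : Hom b c) (h : Hom c d),
    comp (comp f g) h ≅ comp f (comp g h)
  leftUnitor : ∀ {a b} (f : Hom a b), comp (one a) f ≅ f
  rightUnitor : ∀ {a b} (f : Hom a b), comp f (one b) ≅ f
  whiskerLeft_id : ∀ {a b c} (f : Hom a b) (g : Hom b c), whiskerLeft f (𝟙 g) = 𝟙 (comp f g)
  whiskerLeft_comp : ∀ {a b c} (f : Hom a b) {g h i : Hom b c} (η : g ⟶ h) (θ : h ⟶ i),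
    whiskerLeft f (η ≫ θ) = whiskerLeft f η ≫ whiskerLeft f θ
  id_whiskerLeft : ∀ {a b} {f g : Hom a b} (η : f ⟶ g),
    whiskerLeft (one a) η = (leftUnitor f).hom ≫ η ≫ (leftUnitor g).inv
  comp_whiskerLeft : ∀ {a b c d} (f : Hom a b) (g : Hom b c) {h h' : Hom c d} (η : h ⟶ h'),
    whiskerLeft (comp f g) η =
      (associator f g h).hom ≫ whiskerLeft f (whiskerLeft g η) ≫ (associator f g h').inv
  id_whiskerRight : ∀ {a b c} (f : Hom a b) (g : Hom b c), whiskerRight (𝟙 f) g = 𝟙 (comp f g)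
  comp_whiskerRight : ∀ {a b c} {f g h : Hom a b} (η : f ⟶ g) (θ : g ⟶ h) (i : Hom b c),
    whiskerRight (η ≫ θ) i = whiskerRight η i ≫ whiskerRight θ i
  whiskerRight_id : ∀ {a b} {f g : Hom a b} (η : f ⟶ g),
    whiskerRight η (one b) = (rightUnitor f).hom ≫ η ≫ (rightUnitor g).inv
  whiskerRight_comp : ∀ {a b c d} {f f' : Hom a b} (η : f ⟶ f') (g : Hom b c) (h : Hom c d),
    whiskerRight η (comp g h) =
      (associator f g h).inv ≫ whiskerRight (whiskerRight η g) h ≫ (associator f' g h).hom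
  whisker_assoc : ∀ {a b c d} (f : Hom a b) {g g' : Hom b c} (η : g ⟶ g') (h : Hom c d),
    whiskerRight (whiskerLeft f η) h =
      (associator f g h).hom ≫ whiskerLeft f (whiskerRight η h) ≫ (associator f g' h).inv
  whisker_exchange : ∀ {a b c} {f g : Hom a b} {h i : Hom b c} (η : f ⟶ g) (θ : h ⟶ i),
    whiskerLeft f θ ≫ whiskerRight η i = whiskerRight η h ≫ whiskerLeft g θ
  pentagon : ∀ {a b c d e} (f : Hom a b) (g : Hom b c) (h : Hom c d) (i : Hom d e),
    whiskerRight (associator f g h).hom i ≫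
        (associator f (comp g h) i).hom ≫ whiskerLeft f (associator g h i).hom =
      (associator (comp f g) h i).hom ≫ (associator f g (comp h i)).hom
  triangle : ∀ {a b c} (f : Hom a b) (g : Hom b c),
    (associator f (one b) g).hom ≫ whiskerLeft f (leftUnitor g).hom =
      whiskerRight (rightUnitor f).hom g

/-- The bicategory, in the sense of Mathlib, given by a `BicategoryOn`. -/
@[reducible]
def BicategoryOn.toBicategory {O : Type*} {Hom : O → O → Type*} [∀ a b, Category (Hom a b)]
    (𝓑 : BicategoryOn Hom) : Bicategory O where
  Hom := Hom
  id := 𝓑.one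
  comp := 𝓑.comp
  homCategory a b := inferInstanceAs (Category (Hom a b))
  whiskerLeft := 𝓑.whiskerLeft
  whiskerRight := 𝓑.whiskerRight
  associator := 𝓑.associator
  leftUnitor := 𝓑.leftUnitor
  rightUnitor := 𝓑.rightUnitor
  whiskerLeft_id := 𝓑.whiskerLeft_id
  whiskerLeft_comp := 𝓑.whiskerLeft_comp
  id_whiskerLeft := 𝓑.id_whiskerLeft
  comp_whiskerLeft := 𝓑.comp_whiskerLeft
  id_whiskerRight := 𝓑.id_whiskerRight
  comp_whiskerRight := 𝓑.comp_whiskerRight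
  whiskerRight_id := 𝓑.whiskerRight_id
  whiskerRight_comp := 𝓑.whiskerRight_comp
  whisker_assoc := 𝓑.whisker_assoc
  whisker_exchange := 𝓑.whisker_exchange
  pentagon := 𝓑.pentagon
  triangle := 𝓑.triangle

end SemiAb

/-!
Morphisms with arbitrary domain are treated as generalized elements, and regular epimorphisms as
covers, so that "locally" means after precomposition with a regular epimorphism.

Protomodularity enters through one principle: the kernel and the section of a split extension are
jointly epic (`hom_ext_of_split`), and so are the two injections into a pullback of split
epimorphisms (`hom_ext_of_split_pullback`). It follows that reflexive relations are equivalence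
relations, and, by exactness, that a reflexive graph has a quotient in which two elements are
identified exactly when they are locally joined by an edge (`exists_quotient`). Applied to suitable
graphs, this provides cokernels (`exists_cokernel`), shows that a subobject stable under conjugation
is the kernel of its cokernel (`IsCokernel.isKernel_of_conj`), and gives the semidirect product
`G₁ = G ⋊ G₀` as a split extension with kernel `G` (`exists_semidirect`).

For a crossed module, the Peiffer identity provides a morphism `(a, b) ↦ g a ∘ (g b)⁻¹` from `G × G`
to `G₁` before any groupoid structure is known (`Realization.diff`). Its restriction `h` to the
second factor is a kernel of the domain map `d` (`Realization.isKernel_h`), so that `diff` says that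
the kernels of `c` and `d` commute in the sense of Huq. By the implication "Huq ⇒ Smith" the kernel
pairs of `c` and `d` are connected by a partial Mal'tsev operation `Φ`, and `Φ (f, 1, f')` is the
composition of a groupoid whose inverse map exchanges `g` and `h` (`Realization.exists_groupoid`).
This is the identity butterfly, and the only use of the implication.

Given butterflies `E` and `E'`, the morphism `⟨ι, κ'⟩` into the pullback is stable under
conjugation, hence normal. With this, the induced leg `ι` of the cokernel is shown to be a kernel of
`σ`, and equivariance descends because `q ♭ 1` is epic for a regular epimorphism `q`
(`epi_flatMap`, `Butterfly.exists_comp`). Morphisms of butterflies are isomorphisms by the short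
five lemma (`Butterfly.Hom.isIso_hom`).

The elements `[x, y]` cover a composite, so 2-cells out of composites are defined and compared on
them. The unitors are best given by their inverses `x ↦ [e (σ x), x]` and `x ↦ [x, e (ρ x)]`: a
morphism of butterflies is automatically invertible, so only compatibility with the legs is needed
(`Ident.leftInv`, `Ident.rightInv`). All laws of a bicategory then reduce to comparing values on
elements.
-/

namespace SemiAb

attribute [local simp] pullback.lift_fst pullback.lift_snd pullback.lift_fst_assoc
  pullback.lift_snd_assoc prod.lift_fst prod.lift_snd prod.lift_fst_assoc prod.lift_snd_assoc
  coprod.inl_desc coprod.inr_desc coprod.inl_desc_assoc coprod.inr_desc_assoc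

/-! ### Kernels, cokernels and covers -/

section Kernels

variable {C : Type u} [Category.{v} C] [HasZeroMorphisms C]

theorem isKernel_kernel {A B : C} (p : A ⟶ B) [HasKernel p] : IsKernel (kernel.ι p) p :=
  ⟨kernel.condition p, ⟨kernelIsKernel p⟩⟩

theorem IsKernel.w {K A B : C} {k : K ⟶ A} {p : A ⟶ B} (h : IsKernel k p) : k ≫ p = 0 :=
  h.choose

theorem IsKernel.mono {K A B : C} {k : K ⟶ A} {p : A ⟶ B} (h : IsKernel k p) : Mono k := by
  obtain ⟨w, ⟨hl⟩⟩ := h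
  exact ⟨fun a b hab => Fork.IsLimit.hom_ext hl hab⟩

theorem IsKernel.exists_lift {K A B : C} {k : K ⟶ A} {p : A ⟶ B} (h : IsKernel k p)
    {T : C} (t : T ⟶ A) (ht : t ≫ p = 0) : ∃ a : T ⟶ K, a ≫ k = t := by
  obtain ⟨w, ⟨hl⟩⟩ := h
  exact ⟨hl.lift (KernelFork.ofι t ht), hl.fac (KernelFork.ofι t ht) WalkingParallelPair.zero⟩

theorem IsKernel.of_exists_lift {K A B : C} {k : K ⟶ A} {p : A ⟶ B} [Mono k] (w : k ≫ p = 0)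
    (h : ∀ {T : C} (t : T ⟶ A), t ≫ p = 0 → ∃ a : T ⟶ K, a ≫ k = t) : IsKernel k p :=
  ⟨w, ⟨KernelFork.IsLimit.ofι' k w fun t ht => ⟨(h t ht).choose, (h t ht).choose_spec⟩⟩⟩

theorem IsCokernel.w {A B Q : C} {f : A ⟶ B} {q : B ⟶ Q} (h : IsCokernel f q) : f ≫ q = 0 :=
  h.choose

theorem IsCokernel.isRegularEpi {A B Q : C} {f : A ⟶ B} {q : B ⟶ Q} (h : IsCokernel f q) :
    IsRegularEpi q := by
  obtain ⟨w, ⟨hl⟩⟩ := h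
  exact ⟨⟨⟨A, f, 0, by rw [w, zero_comp], hl⟩⟩⟩

theorem IsCokernel.epi {A B Q : C} {f : A ⟶ B} {q : B ⟶ Q} (h : IsCokernel f q) : Epi q :=
  have := h.isRegularEpi
  inferInstance

theorem IsCokernel.exists_desc {A B Q : C} {f : A ⟶ B} {q : B ⟶ Q} (h : IsCokernel f q)
    {Z : C} (t : B ⟶ Z) (ht : f ≫ t = 0) : ∃ a : Q ⟶ Z, q ≫ a = t := by
  obtain ⟨w, ⟨hl⟩⟩ := h
  exact ⟨hl.desc (CokernelCofork.ofπ t ht),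
    hl.fac (CokernelCofork.ofπ t ht) WalkingParallelPair.one⟩

end Kernels

section Regular

variable {C : Type u} [Category.{v} C]

theorem isRegularEpi_of_strongEpi [Regular C] {X Y : C} (f : X ⟶ Y) [StrongEpi f] :
    IsRegularEpi f := by
  have : ExtremalEpi f := inferInstance
  infer_instance

theorem isRegularEpi_of_comp [Regular C] {X Y Z : C} (f : X ⟶ Y) (g : Y ⟶ Z)
    [IsRegularEpi (f ≫ g)] : IsRegularEpi g :=
  have := strongEpi_of_strongEpi f g
  isRegularEpi_of_strongEpi g

theorem isRegularEpi_comp [Regular C] {X Y Z : C} (f : X ⟶ Y) (g : Y ⟶ Z)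
    [IsRegularEpi f] [IsRegularEpi g] : IsRegularEpi (f ≫ g) :=
  isRegularEpi_of_strongEpi _

/-- A morphism that factors through a monomorphism locally, on a cover, factors through it. -/
theorem exists_fac_of_cover {T' T M A : C} (e : T' ⟶ T) [IsRegularEpi e] (m : M ⟶ A) [Mono m]
    (a : T' ⟶ M) (t : T ⟶ A) (h : a ≫ m = e ≫ t) : ∃ b : T ⟶ M, b ≫ m = t :=
  have sq : CommSq a e m t := ⟨h⟩
  ⟨sq.lift, sq.fac_right⟩

/-- If any two elements of `A` identified by the cover `q` are locally joined by an edge of the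
graph `u, v`, then `q` is a coequalizer of `u` and `v`. -/
theorem exists_desc_of_quotient {S A Q Z : C} {u v : S ⟶ A} {q : A ⟶ Q} [IsRegularEpi q]
    (hq : ∀ {T : C} (a b : T ⟶ A), a ≫ q = b ≫ q →
        ∃ (T' : C) (e : T' ⟶ T) (z : T' ⟶ S), IsRegularEpi e ∧ z ≫ u = e ≫ a ∧ z ≫ v = e ≫ b)
    (f : A ⟶ Z) (hf : u ≫ f = v ≫ f) : ∃ f' : Q ⟶ Z, q ≫ f' = f := by
  refine ⟨IsRegularEpi.desc q f ?_, IsRegularEpi.fac _ _ _⟩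
  obtain ⟨T', e, z, he, h₁, h₂⟩ := hq _ _ (IsRegularEpi.w q)
  rw [← cancel_epi e, ← Category.assoc, ← Category.assoc, ← h₁, ← h₂, Category.assoc,
    Category.assoc, hf]

end Regular

/-! ### Protomodularity -/

section Protomodular

variable {C : Type u} [Category.{v} C] [HasZeroMorphisms C] [SemiAbelian C]

/-- In a split extension, a subobject containing the kernel and the section is everything. -/
theorem isIso_of_split {K A B M : C} {k : K ⟶ A} {p : A ⟶ B} {s : B ⟶ A} (hk : IsKernel k p)
    (hs : s ≫ p = 𝟙 B) (m : M ⟶ A) [Mono m] (a : K ⟶ M) (ha : a ≫ m = k) (b : B ⟶ M)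
    (hb : b ≫ m = s) : IsIso m := by
  have : Mono k := hk.mono
  have : Mono (a ≫ m) := ha ▸ inferInstance
  have : Mono a := mono_of_mono a m
  have hka : IsKernel a (m ≫ p) := by
    refine IsKernel.of_exists_lift (by rw [← Category.assoc, ha, hk.w]) fun t ht => ?_
    obtain ⟨x, hx⟩ := hk.exists_lift (t ≫ m) (by rw [Category.assoc, ht])
    exact ⟨x, by rw [← cancel_mono m, Category.assoc, ha, hx]⟩
  exact SemiAbelian.split_short_five a (m ≫ p) b k p s (𝟙 K) m (𝟙 B) hka
    (by rw [← Category.assoc, hb, hs]) hk hs (by rw [ha, Category.id_comp])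
    (by rw [Category.comp_id]) (by rw [hb, Category.id_comp]) inferInstance inferInstance

/-- The kernel and the section of a split extension are jointly epic. Most equalities of morphisms
below are reduced to this. -/
theorem hom_ext_of_split {K A B Z : C} {k : K ⟶ A} {p : A ⟶ B} {s : B ⟶ A} (hk : IsKernel k p)
    (hs : s ≫ p = 𝟙 B) {f g : A ⟶ Z} (h₁ : k ≫ f = k ≫ g) (h₂ : s ≫ f = s ≫ g) : f = g := by
  have := isIso_of_split hk hs (equalizer.ι f g) (equalizer.lift k h₁) (equalizer.lift_ι _ _)
    (equalizer.lift s h₂) (equalizer.lift_ι _ _)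
  rw [← cancel_epi (equalizer.ι f g), equalizer.condition]

theorem isKernel_pullback_fst {X Y Z K : C} (f : X ⟶ Z) (g : Y ⟶ Z) {k : K ⟶ Y}
    (hk : IsKernel k g) :
    IsKernel (pullback.lift 0 k (by rw [hk.w, zero_comp])) (pullback.fst f g) := by
  have := hk.mono
  have : Mono (pullback.lift 0 k (by rw [hk.w, zero_comp]) : K ⟶ pullback f g) := by
    have : Mono ((pullback.lift 0 k (by rw [hk.w, zero_comp]) : K ⟶ pullback f g) ≫
      pullback.snd f g) := by rw [pullback.lift_snd]; infer_instance
    exact mono_of_mono _ (pullback.snd f g)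
  refine IsKernel.of_exists_lift (by rw [pullback.lift_fst]) fun t ht => ?_
  obtain ⟨x, hx⟩ := hk.exists_lift (t ≫ pullback.snd f g)
    (by rw [Category.assoc, ← pullback.condition, ← Category.assoc, ht, zero_comp])
  exact ⟨x, pullback.hom_ext (by simp [ht]) (by simp [hx])⟩

theorem isKernel_pullback_snd {X Y Z K : C} (f : X ⟶ Z) (g : Y ⟶ Z) {k : K ⟶ X}
    (hk : IsKernel k f) :
    IsKernel (pullback.lift k 0 (by rw [hk.w, zero_comp])) (pullback.snd f g) := by
  have := hk.mono
  have : Mono (pullback.lift k 0 (by rw [hk.w, zero_comp]) : K ⟶ pullback f g) := by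
    have : Mono ((pullback.lift k 0 (by rw [hk.w, zero_comp]) : K ⟶ pullback f g) ≫
      pullback.fst f g) := by rw [pullback.lift_fst]; infer_instance
    exact mono_of_mono _ (pullback.fst f g)
  refine IsKernel.of_exists_lift (by rw [pullback.lift_snd]) fun t ht => ?_
  obtain ⟨x, hx⟩ := hk.exists_lift (t ≫ pullback.fst f g)
    (by rw [Category.assoc, pullback.condition, ← Category.assoc, ht, zero_comp])
  exact ⟨x, pullback.hom_ext (by simp [hx]) (by simp [ht])⟩

/-- In a pullback of split epimorphisms, a subobject containing the two canonical injections is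
everything: this is the Mal'tsev property. -/
theorem isIso_of_split_pullback {X Y Z M : C} {f : X ⟶ Z} {g : Y ⟶ Z} {r : Z ⟶ X} {s : Z ⟶ Y}
    (hr : r ≫ f = 𝟙 Z) (hs : s ≫ g = 𝟙 Z) (m : M ⟶ pullback f g) [Mono m]
    (a : X ⟶ M) (ha : a ≫ m = pullback.lift (𝟙 X) (f ≫ s) (by simp [hs]))
    (b : Y ⟶ M) (hb : b ≫ m = pullback.lift (g ≫ r) (𝟙 Y) (by simp [hr])) : IsIso m := by
  refine isIso_of_split (isKernel_pullback_fst f g (isKernel_kernel g)) (s := a ≫ m)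
    (by rw [ha, pullback.lift_fst]) m (kernel.ι g ≫ b) ?_ a rfl
  rw [Category.assoc, hb]
  exact pullback.hom_ext (by simp) (by simp)

/-- The two canonical injections into a pullback of split epimorphisms are jointly epic. -/
theorem hom_ext_of_split_pullback {X Y Z W : C} {f : X ⟶ Z} {g : Y ⟶ Z} {r : Z ⟶ X} {s : Z ⟶ Y}
    (hr : r ≫ f = 𝟙 Z) (hs : s ≫ g = 𝟙 Z) {F G : pullback f g ⟶ W}
    (h₁ : pullback.lift (𝟙 X) (f ≫ s) (by simp [hs]) ≫ F =
      pullback.lift (𝟙 X) (f ≫ s) (by simp [hs]) ≫ G)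
    (h₂ : pullback.lift (g ≫ r) (𝟙 Y) (by simp [hr]) ≫ F =
      pullback.lift (g ≫ r) (𝟙 Y) (by simp [hr]) ≫ G) : F = G := by
  have := isIso_of_split_pullback hr hs (equalizer.ι F G) (equalizer.lift _ h₁)
    (equalizer.lift_ι _ _) (equalizer.lift _ h₂) (equalizer.lift_ι _ _)
  rw [← cancel_epi (equalizer.ι F G), equalizer.condition]

theorem isKernel_prod_snd (X Y : C) :
    IsKernel (prod.lift (𝟙 X) (0 : X ⟶ Y)) (prod.snd : X ⨯ Y ⟶ Y) := by
  have : Mono (prod.lift (𝟙 X) (0 : X ⟶ Y)) := by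
    have : Mono (prod.lift (𝟙 X) (0 : X ⟶ Y) ≫ prod.fst) := by
      rw [prod.lift_fst]; infer_instance
    exact mono_of_mono _ prod.fst
  refine IsKernel.of_exists_lift (by simp) fun t ht => ⟨t ≫ prod.fst, ?_⟩
  ext <;> simp [ht]

theorem isKernel_prod_fst (X Y : C) :
    IsKernel (prod.lift (0 : Y ⟶ X) (𝟙 Y)) (prod.fst : X ⨯ Y ⟶ X) := by
  have : Mono (prod.lift (0 : Y ⟶ X) (𝟙 Y)) := by
    have : Mono (prod.lift (0 : Y ⟶ X) (𝟙 Y) ≫ prod.snd) := by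
      rw [prod.lift_snd]; infer_instance
    exact mono_of_mono _ prod.snd
  refine IsKernel.of_exists_lift (by simp) fun t ht => ⟨t ≫ prod.snd, ?_⟩
  ext <;> simp [ht]

/-- The two injections into a product are jointly epic. -/
theorem prod_hom_ext {X Y W : C} {F G : X ⨯ Y ⟶ W}
    (h₁ : prod.lift (𝟙 X) 0 ≫ F = prod.lift (𝟙 X) 0 ≫ G)
    (h₂ : prod.lift 0 (𝟙 Y) ≫ F = prod.lift 0 (𝟙 Y) ≫ G) : F = G :=
  hom_ext_of_split (isKernel_prod_snd X Y) (s := prod.lift 0 (𝟙 Y)) (by simp) h₁ h₂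

/-- Two elements with the same image under `f` are not distinguished by a morphism that vanishes on
the kernel of `f`. -/
theorem comp_eq_of_comp_eq {K A B Z T : C} {k : K ⟶ A} {f : A ⟶ B} (hk : IsKernel k f)
    (t : A ⟶ Z) (ht : k ≫ t = 0) (x y : T ⟶ A) (hxy : x ≫ f = y ≫ f) : x ≫ t = y ≫ t := by
  have key : pullback.fst f f ≫ t = pullback.snd f f ≫ t := by
    refine hom_ext_of_split (isKernel_pullback_fst f f hk)
      (s := pullback.lift (𝟙 A) (𝟙 A) rfl) (by simp) ?_ ?_
    · simp [ht]
    · simp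
  rw [← pullback.lift_fst x y hxy, Category.assoc, key, pullback.lift_snd_assoc]

/-- A morphism with trivial kernel is a monomorphism. -/
theorem mono_of_eq_zero {A B : C} (f : A ⟶ B)
    (h : ∀ {T : C} (t : T ⟶ A), t ≫ f = 0 → t = 0) : Mono f := by
  refine ⟨fun x y hxy => ?_⟩
  have := comp_eq_of_comp_eq (isKernel_kernel f) (𝟙 A)
    (by rw [h _ (kernel.condition f), zero_comp]) x y hxy
  simpa using this

/-- A regular epimorphism is the cokernel of its kernel. -/
theorem IsKernel.isCokernel {K A B : C} {k : K ⟶ A} {p : A ⟶ B} (hk : IsKernel k p)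
    [IsRegularEpi p] : IsCokernel k p := by
  refine ⟨hk.w, ⟨CokernelCofork.IsColimit.ofπ' p hk.w fun t ht => ?_⟩⟩
  exact ⟨IsRegularEpi.desc p t (comp_eq_of_comp_eq hk t ht _ _ (IsRegularEpi.w p)),
    IsRegularEpi.fac _ _ _⟩

/-! ### Reflexive relations and quotients of reflexive graphs -/

/-- Every relation is difunctional: if `a R b`, `c R b` and `c R d`, then `a R d`. -/
theorem difunctional {R A : C} {p₁ p₂ : R ⟶ A} [JointlyMono₂ p₁ p₂]
    {T : C} (x y z : T ⟶ R) (hxy : x ≫ p₂ = y ≫ p₂) (hyz : y ≫ p₁ = z ≫ p₁) :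
    ∃ w : T ⟶ R, w ≫ p₁ = x ≫ p₁ ∧ w ≫ p₂ = z ≫ p₂ := by
  -- the zigzags `x, y, z` form a pullback of split epimorphisms over `R`; those whose ends are
  -- related contain both injections, hence are all
  let f := pullback.snd p₂ p₂
  let g := pullback.fst p₁ p₁
  let r : R ⟶ pullback p₂ p₂ := pullback.lift (𝟙 R) (𝟙 R) rfl
  let s : R ⟶ pullback p₁ p₁ := pullback.lift (𝟙 R) (𝟙 R) rfl
  let u : pullback f g ⟶ A ⨯ A := prod.lift (pullback.fst f g ≫ pullback.fst p₂ p₂ ≫ p₁)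
    (pullback.snd f g ≫ pullback.snd p₁ p₁ ≫ p₂)
  let m : R ⟶ A ⨯ A := prod.lift p₁ p₂
  have : Mono m := ⟨fun a b hab => JointlyMono₂.right_cancellation (p₁ := p₁) (p₂ := p₂) a b
    (by simpa [m] using congrArg (· ≫ prod.fst) hab)
    (by simpa [m] using congrArg (· ≫ prod.snd) hab)⟩
  have hr : r ≫ f = 𝟙 R := by simp [r, f]
  have hs : s ≫ g = 𝟙 R := by simp [s, g]
  have hiso : IsIso (pullback.fst u m) := by
    refine isIso_of_split_pullback hr hs _
      (pullback.lift (pullback.lift (𝟙 _) (f ≫ s) (by simp [hs])) (pullback.fst p₂ p₂) ?_)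
      (pullback.lift_fst _ _ _)
      (pullback.lift (pullback.lift (g ≫ r) (𝟙 _) (by simp [hr])) (pullback.snd p₁ p₁) ?_)
      (pullback.lift_fst _ _ _)
    · ext
      · simp [u, m]
      · simp [u, m, f, s, pullback.condition]
    · ext
      · simp [u, m, g, r, pullback.condition]
      · simp [u, m]
  let t : T ⟶ pullback f g := pullback.lift (pullback.lift x y hxy) (pullback.lift y z hyz)
    (by simp [f, g])
  have h : (t ≫ inv (pullback.fst u m) ≫ pullback.snd u m) ≫ m = t ≫ u := by
    simp [← pullback.condition]
  refine ⟨t ≫ inv (pullback.fst u m) ≫ pullback.snd u m, ?_, ?_⟩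
  · simpa [m, u, t] using congrArg (· ≫ prod.fst) h
  · simpa [m, u, t] using congrArg (· ≫ prod.snd) h

/-- The Mal'tsev property: a reflexive relation is an equivalence relation. -/
theorem isEquivalenceRelation_of_reflexive {R A : C} {p₁ p₂ : R ⟶ A} [JointlyMono₂ p₁ p₂]
    (r : A ⟶ R) (h₁ : r ≫ p₁ = 𝟙 A) (h₂ : r ≫ p₂ = 𝟙 A) : IsEquivalenceRelation p₁ p₂ := by
  obtain ⟨s, hs₁, hs₂⟩ := difunctional (p₁ := p₁) (p₂ := p₂) (p₂ ≫ r) (𝟙 R) (p₁ ≫ r)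
    (by simp [h₂]) (by simp [h₁])
  obtain ⟨t, ht₁, ht₂⟩ := difunctional (p₁ := p₁) (p₂ := p₂) (pullback.fst p₂ p₁)
    (pullback.snd p₂ p₁ ≫ p₁ ≫ r) (pullback.snd p₂ p₁)
    (by simp [h₂, pullback.condition]) (by simp [h₁])
  exact ⟨⟨{
    right_cancellation := JointlyMono₂.right_cancellation
    r := r
    reflexivity₁ := h₁
    reflexivity₂ := h₂
    s := s
    symmetry₁ := by simpa [h₁] using hs₁
    symmetry₂ := by simpa [h₂] using hs₂
    c := pullback.cone p₂ p₁
    isLimit := pullback.isLimit p₂ p₁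
    t := t
    transitivity₁ := ht₁
    transitivity₂ := ht₂ }⟩⟩

/-- The quotient of a reflexive graph: two elements are identified exactly when they are,
locally, the two ends of an edge. -/
theorem exists_quotient {S A : C} (u v : S ⟶ A) (s : A ⟶ S) (hu : s ≫ u = 𝟙 A)
    (hv : s ≫ v = 𝟙 A) :
    ∃ (Q : C) (q : A ⟶ Q), IsRegularEpi q ∧ u ≫ q = v ≫ q ∧
      ∀ {T : C} (a b : T ⟶ A), a ≫ q = b ≫ q →
        ∃ (T' : C) (e : T' ⟶ T) (z : T' ⟶ S), IsRegularEpi e ∧ z ≫ u = e ≫ a ∧ z ≫ v = e ≫ b := by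
  -- the image of `(u, v)` is a reflexive relation, hence the kernel pair of some `f`; the
  -- quotient is the image of `f`
  let F := Regular.strongEpiMonoFactorisation (prod.lift u v)
  let p₁ : F.I ⟶ A := F.m ≫ prod.fst
  let p₂ : F.I ⟶ A := F.m ≫ prod.snd
  have he₁ : F.e ≫ p₁ = u := by
    have := F.fac
    simp only [p₁, ← Category.assoc, this, prod.lift_fst]
  have he₂ : F.e ≫ p₂ = v := by
    have := F.fac
    simp only [p₂, ← Category.assoc, this, prod.lift_snd]
  have : JointlyMono₂ p₁ p₂ := ⟨fun _ a b h₁ h₂ => by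
    rw [← cancel_mono F.m]
    ext
    · simpa [p₁] using h₁
    · simpa [p₂] using h₂⟩
  have := isEquivalenceRelation_of_reflexive (p₁ := p₁) (p₂ := p₂) (s ≫ F.e)
    (by rw [Category.assoc, he₁, hu]) (by rw [Category.assoc, he₂, hv])
  obtain ⟨Y, f, hf⟩ := SemiAbelian.effective p₁ p₂ this
  let G := Regular.strongEpiMonoFactorisation f
  have hG : G.e ≫ G.m = f := G.fac
  refine ⟨G.I, G.e, inferInstance, ?_, fun {T} a b hab => ?_⟩
  · have h := congrArg (F.e ≫ ·) hf.w
    simp only [← Category.assoc, he₁, he₂] at h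
    rw [← cancel_mono G.m, Category.assoc, Category.assoc, hG, h]
  · have hab' : a ≫ f = b ≫ f := by rw [← hG, ← Category.assoc, hab, Category.assoc]
    refine ⟨pullback F.e (hf.lift a b hab'), pullback.snd _ _, pullback.fst _ _, inferInstance,
      ?_, ?_⟩
    · have h := pullback.condition (f := F.e) (g := hf.lift a b hab') =≫ p₁
      rwa [Category.assoc, Category.assoc, he₁, hf.lift_fst] at h
    · have h := pullback.condition (f := F.e) (g := hf.lift a b hab') =≫ p₂
      rwa [Category.assoc, Category.assoc, he₂, hf.lift_snd] at h

end Protomodular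

/-! ### Bracketed morphisms on `B ♭ X` -/

section Brk

variable {C : Type u} [Category.{v} C] [HasZeroMorphisms C] [HasFiniteLimits C]
  [HasFiniteCoproducts C]

/-- The restriction of `[a, b] : B + X ⟶ A` to `B ♭ X`; for `a = b = 1` it is the conjugation. -/
noncomputable def brk {A B X : C} (a : B ⟶ A) (b : X ⟶ A) : flat B X ⟶ A :=
  flatι B X ≫ coprod.desc a b

instance {B X : C} : Mono (flatι B X) :=
  inferInstanceAs (Mono (kernel.ι _))

theorem isKernel_flatι (B X : C) : IsKernel (flatι B X) (coprod.desc (𝟙 B) (0 : X ⟶ B)) :=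
  isKernel_kernel _

theorem flatMap_ι {B B' X X' : C} (f : B ⟶ B') (g : X ⟶ X') :
    flatMap f g ≫ flatι B' X' = flatι B X ≫ coprod.map f g :=
  kernel.lift_ι _ _ _

theorem flatUnit_ι (B X : C) : flatUnit B X ≫ flatι B X = coprod.inr :=
  kernel.lift_ι _ _ _

theorem flatMul_ι (B X : C) : flatMul B X ≫ flatι B X =
    flatι B (flat B X) ≫ coprod.desc coprod.inl (flatι B X) :=
  kernel.lift_ι _ _ _

theorem brk_comp {A A' B X : C} (a : B ⟶ A) (b : X ⟶ A) (f : A ⟶ A') :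
    brk a b ≫ f = brk (a ≫ f) (b ≫ f) := by
  simp only [brk, Category.assoc, coprod.desc_comp]

theorem flatMap_brk {A B B' X X' : C} (f : B ⟶ B') (g : X ⟶ X') (a : B' ⟶ A) (b : X' ⟶ A) :
    flatMap f g ≫ brk a b = brk (f ≫ a) (g ≫ b) := by
  rw [brk, ← Category.assoc, flatMap_ι, Category.assoc, coprod.map_desc, brk]

theorem conj_eq_brk (X : C) : conj X = brk (𝟙 X) (𝟙 X) := rfl

theorem flatMap_conj {B X A : C} (f : B ⟶ A) (g : X ⟶ A) : flatMap f g ≫ conj A = brk f g := by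
  rw [conj_eq_brk, flatMap_brk, Category.comp_id, Category.comp_id]

theorem flatMap_comp {B B' B'' X X' X'' : C} (f : B ⟶ B') (g : X ⟶ X') (f' : B' ⟶ B'')
    (g' : X' ⟶ X'') : flatMap f g ≫ flatMap f' g' = flatMap (f ≫ f') (g ≫ g') := by
  rw [← cancel_mono (flatι B'' X''), Category.assoc, flatMap_ι, ← Category.assoc, flatMap_ι,
    flatMap_ι, Category.assoc, coprod.map_map]

theorem brk_zero_right {A B X : C} (a : B ⟶ A) : brk a (0 : X ⟶ A) = 0 := by
  have h : coprod.desc a (0 : X ⟶ A) = coprod.desc (𝟙 B) 0 ≫ a := by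
    rw [coprod.desc_comp, Category.id_comp, zero_comp]
  rw [brk, h, ← Category.assoc, flatι_desc, zero_comp]

end Brk

/-! ### Normal subobjects and regular pushouts -/

variable {C : Type u} [Category.{v} C] [HasZeroMorphisms C] [SemiAbelian C]

/-- A subobject `k` stable under conjugation is normal: it is the kernel of any cokernel `q` of
`k`. -/
theorem IsCokernel.isKernel_of_conj {K A Q : C} {k : K ⟶ A} [Mono k] {q : A ⟶ Q}
    (hq : IsCokernel k q) (w : flat A K ⟶ K) (hw : w ≫ k = brk (𝟙 A) k) : IsKernel k q := by
  -- in the graph with edges from `a` to `a + k x`, an element joined to `0` comes locally from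
  -- `A ♭ K`, where `[1, k]` factors through `k`
  obtain ⟨Q', q', hq', huv, hloc⟩ := exists_quotient (coprod.desc (𝟙 A) (0 : K ⟶ A))
    (coprod.desc (𝟙 A) k) coprod.inl (by simp) (by simp)
  have hk : k ≫ q' = 0 := by
    simpa using (coprod.inr ≫= huv).symm
  obtain ⟨r, hr⟩ := hq.exists_desc q' hk
  refine IsKernel.of_exists_lift hq.w fun {T} t ht => ?_
  obtain ⟨T', e, z, he, h₁, h₂⟩ := hloc 0 t
    (by rw [zero_comp, ← hr, ← Category.assoc, ht, zero_comp])
  obtain ⟨z', hz'⟩ := (isKernel_flatι A K).exists_lift z (by rw [h₁, comp_zero])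
  refine exists_fac_of_cover e k (z' ≫ w) t ?_
  rw [← h₂, ← hz', Category.assoc, hw, brk, Category.assoc]

/-- A morphism of split epimorphisms consisting of regular epimorphisms is a regular pushout: the
comparison with the pullback is a regular epimorphism. -/
theorem isRegularEpi_pullback_lift {A B A' B' : C} {p : A ⟶ B} {s : B ⟶ A} {p' : A' ⟶ B'}
    {s' : B' ⟶ A'} (f : A ⟶ A') (g : B ⟶ B') (hs : s ≫ p = 𝟙 B) (hf : f ≫ p' = p ≫ g)
    (hsf : s ≫ f = g ≫ s') [IsRegularEpi f] :
    IsRegularEpi (pullback.lift p f hf.symm : A ⟶ pullback g p') := by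
  let F := Regular.strongEpiMonoFactorisation (pullback.lift p f hf.symm : A ⟶ pullback g p')
  have hF : F.e ≫ F.m = pullback.lift p f hf.symm := F.fac
  -- the elements `(a, (b, b'))` of `A ×_B Eq(g)` cover the pullback
  let P := pullback p (pullback.fst g g)
  let t : P ⟶ pullback g p' := pullback.lift (pullback.snd p (pullback.fst g g) ≫ pullback.snd g g)
    (pullback.fst p (pullback.fst g g) ≫ f) (by
      rw [Category.assoc, Category.assoc, hf, pullback.condition_assoc, pullback.condition])
  have ht : IsRegularEpi t := by
    have hsq : IsPullback t (pullback.fst p (pullback.fst g g)) (pullback.snd g p') f := by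
      refine ⟨⟨by simp [t]⟩, ⟨PullbackCone.IsLimit.mk _
        (fun c => pullback.lift c.snd (pullback.lift (c.snd ≫ p) (c.fst ≫ pullback.fst g p') ?_)
          ?_) ?_ ?_ ?_⟩⟩
      · rw [Category.assoc, Category.assoc, ← hf, ← reassoc_of% c.condition,
          ← pullback.condition]
      · simp
      · intro c
        have := c.condition
        ext <;> simp [t, this]
      · intro c
        simp
      · intro c m h₁ h₂
        refine pullback.hom_ext (by simp [h₂]) (pullback.hom_ext ?_ ?_)
        · simp [← h₂, pullback.condition]
        · simp [← h₁, t]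
    exact (Regular.regularEpiIsStableUnderBaseChange (C := C)).of_isPullback hsq.flip
      (by simpa using ‹IsRegularEpi f›)
  have hr : (pullback.lift (𝟙 B) (𝟙 B) rfl : B ⟶ pullback g g) ≫ pullback.fst g g = 𝟙 B := by simp
  have hiso : IsIso (pullback.fst t F.m) := by
    refine isIso_of_split_pullback hs hr _
      (pullback.lift (pullback.lift (𝟙 _) (p ≫ pullback.lift (𝟙 B) (𝟙 B) rfl) (by simp)) F.e ?_)
      (pullback.lift_fst _ _ _)
      (pullback.lift (pullback.lift (pullback.fst g g ≫ s) (𝟙 _) (by simp [hs]))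
        (pullback.snd g g ≫ s ≫ F.e) ?_)
      (pullback.lift_fst _ _ _)
    · rw [hF]
      ext <;> simp [t]
    · simp only [Category.assoc, hF]
      ext <;> simp [t, hs, hsf, pullback.condition_assoc]
  have : IsRegularEpi ((inv (pullback.fst t F.m) ≫ pullback.snd t F.m) ≫ F.m) := by
    rw [Category.assoc, ← pullback.condition, IsIso.inv_hom_id_assoc]
    exact ht
  have : IsRegularEpi F.m :=
    isRegularEpi_of_comp (inv (pullback.fst t F.m) ≫ pullback.snd t F.m) F.m
  rw [← hF]
  exact isRegularEpi_comp _ _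

/-- The functor `(-) ♭ X` sends regular epimorphisms to epimorphisms: `q ♭ 1` is a pullback of the
comparison morphism of the regular pushout formed by `q + 1` and `q`. With it, equivariance
conditions on a quotient are checked before passing to the quotient. -/
theorem epi_flatMap {P Q : C} (q : P ⟶ Q) [IsRegularEpi q] (X : C) :
    Epi (flatMap q (𝟙 X)) := by
  have : StrongEpi (coprod.map q (𝟙 X)) := by
    have : Epi (coprod.map q (𝟙 X)) := inferInstance
    refine StrongEpi.mk' fun M N z hz u v sq => ?_
    have sq₁ : CommSq (coprod.inl ≫ u) q z (coprod.inl ≫ v) := ⟨by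
      rw [Category.assoc, sq.w, coprod.inl_map_assoc]⟩
    have sq₂ : coprod.inr ≫ u ≫ z = coprod.inr ≫ v := by
      rw [sq.w, coprod.inr_map_assoc, Category.id_comp]
    refine CommSq.HasLift.mk' ⟨coprod.desc sq₁.lift (coprod.inr ≫ u), ?_, ?_⟩
    · ext <;> simp
    · ext <;> simp [sq₂]
  have : IsRegularEpi (coprod.map q (𝟙 X)) := isRegularEpi_of_strongEpi _
  have hc : coprod.map q (𝟙 X) ≫ coprod.desc (𝟙 Q) 0 = coprod.desc (𝟙 P) 0 ≫ q := by
    ext <;> simp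
  have hl := isRegularEpi_pullback_lift (p := coprod.desc (𝟙 P) (0 : X ⟶ P)) (s := coprod.inl)
    (p' := coprod.desc (𝟙 Q) (0 : X ⟶ Q)) (s' := coprod.inl) (coprod.map q (𝟙 X)) q (by simp) hc
    (by simp)
  have hsq : IsPullback (flatι P X) (flatMap q (𝟙 X)) (pullback.lift _ _ hc.symm)
      (pullback.lift 0 (flatι Q X) (by rw [flatι_desc, zero_comp])) := by
    refine ⟨⟨?_⟩, ⟨PullbackCone.IsLimit.mk _ (fun c => flatLift c.fst ?_) ?_ ?_ ?_⟩⟩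
    · ext
      · simp [flatι_desc]
      · simp [flatMap_ι]
    · simpa using c.condition =≫ pullback.fst _ _
    · intro c
      exact kernel.lift_ι _ _ _
    · intro c
      rw [← cancel_mono (flatι Q X), Category.assoc, flatMap_ι, ← Category.assoc]
      have h := c.condition =≫ pullback.snd _ _
      simp only [Category.assoc, pullback.lift_snd] at h
      rw [← h]
      exact congrArg (· ≫ _) (kernel.lift_ι _ _ _)
    · intro c m h₁ h₂
      rw [← cancel_mono (flatι P X), h₁]
      exact (kernel.lift_ι _ _ _).symm
  have : IsRegularEpi (flatMap q (𝟙 X)) :=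
    (Regular.regularEpiIsStableUnderBaseChange (C := C)).of_isPullback hsq
      (by simpa using hl)
  infer_instance

/-! ### Semidirect products -/

/-- The semidirect product of an action `ξ` of `B` on `X`: the coequalizer of `flatι B X` and
`ξ ≫ coprod.inr` is a split extension of `B` with kernel `X`. -/
theorem exists_semidirect {B X : C} (ξ : InternalAction B X) :
    ∃ (Q : C) (q : B ⨿ X ⟶ Q) (d : Q ⟶ B), IsRegularEpi q ∧
      flatι B X ≫ q = (ξ.act ≫ coprod.inr) ≫ q ∧
      (∀ {Z : C} (f : B ⨿ X ⟶ Z), flatι B X ≫ f = (ξ.act ≫ coprod.inr) ≫ f →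
        ∃ f' : Q ⟶ Z, q ≫ f' = f) ∧
      q ≫ d = coprod.desc (𝟙 B) 0 ∧ IsKernel (coprod.inr ≫ q) d := by
  -- the reflexive graph of free split extensions that presents the semidirect product
  let u : B ⨿ flat B X ⟶ B ⨿ X := coprod.desc coprod.inl (flatι B X)
  let v : B ⨿ flat B X ⟶ B ⨿ X := coprod.map (𝟙 B) ξ.act
  obtain ⟨Q, q, hq, huv, hloc⟩ := exists_quotient u v (coprod.map (𝟙 B) (flatUnit B X))
    (by ext <;> simp [u, flatUnit_ι]) (by ext <;> simp [v, ξ.unit_act])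
  have hup : u ≫ coprod.desc (𝟙 B) 0 = coprod.desc (𝟙 B) 0 := by
    ext <;> simp [u, flatι_desc]
  have hvp : v ≫ coprod.desc (𝟙 B) 0 = coprod.desc (𝟙 B) 0 := by
    ext <;> simp [v]
  have hw : flatι B X ≫ q = (ξ.act ≫ coprod.inr) ≫ q := by
    simpa [u, v] using coprod.inr ≫= huv
  have hdesc : ∀ {Z : C} (f : B ⨿ X ⟶ Z), flatι B X ≫ f = (ξ.act ≫ coprod.inr) ≫ f →
      ∃ f' : Q ⟶ Z, q ≫ f' = f := by
    intro Z f hf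
    refine exists_desc_of_quotient hloc f ?_
    ext
    · simp [u, v]
    · simpa [u, v] using hf
  obtain ⟨d, hd⟩ := hdesc (coprod.desc (𝟙 B) 0) (by simp [flatι_desc])
  refine ⟨Q, q, d, hq, hw, hdesc, hd, ?_⟩
  -- an element of `X` identified with `0` comes locally from an element of `B ♭ (B ♭ X)` whose
  -- images under `flatMul` and `1 ♭ ξ` are `x` and `0`; associativity of `ξ` then gives `x = 0`
  have hmono : Mono (coprod.inr ≫ q : X ⟶ Q) := by
    refine mono_of_eq_zero _ fun {T} t ht => ?_
    obtain ⟨T', e, z, he, h₁, h₂⟩ := hloc (t ≫ coprod.inr) 0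
      (by rw [Category.assoc, ht, zero_comp])
    obtain ⟨z', rfl⟩ := (isKernel_flatι B (flat B X)).exists_lift z
      (by rw [← hvp, ← Category.assoc, h₂, comp_zero, zero_comp])
    have hz₁ : z' ≫ flatMul B X = e ≫ t ≫ flatUnit B X := by
      rw [← cancel_mono (flatι B X), Category.assoc, flatMul_ι, Category.assoc, Category.assoc,
        flatUnit_ι, ← h₁, Category.assoc]
    have hz₂ : z' ≫ flatMap (𝟙 B) ξ.act = 0 := by
      rw [← cancel_mono (flatι B X), Category.assoc, flatMap_ι, ← Category.assoc, h₂, zero_comp,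
        comp_zero]
    have h := hz₁ =≫ ξ.act
    rw [Category.assoc, ξ.mul_act, ← Category.assoc, hz₂, zero_comp] at h
    simp only [Category.assoc, ξ.unit_act, Category.comp_id] at h
    rw [← cancel_epi e, ← h, comp_zero]
  refine IsKernel.of_exists_lift (by rw [Category.assoc, hd, coprod.inr_desc]) fun {T} t ht => ?_
  -- locally, an element of the kernel lifts to `B ♭ X`
  obtain ⟨y, hy⟩ := (isKernel_flatι B X).exists_lift (pullback.snd t q)
    (by rw [← hd, ← pullback.condition_assoc, ht, comp_zero])
  refine exists_fac_of_cover (pullback.fst t q) _ (y ≫ ξ.act) t ?_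
  rw [pullback.condition, ← hy, Category.assoc, Category.assoc, hw, Category.assoc]

/-- A realization of the reflexive graph of a crossed module `G`: an object `G₁ = G ⋊ G₀` with
`e : G₀ ⟶ G₁`, `g : G ⟶ G₁` and the two projections `d, c : G₁ ⟶ G₀`. -/
structure Realization (G : CrossedModule C) where
  obj : C
  e : G.base ⟶ obj
  g : G.top ⟶ obj
  d : obj ⟶ G.base
  c : obj ⟶ G.base
  e_d : e ≫ d = 𝟙 _
  e_c : e ≫ c = 𝟙 _
  g_d : g ≫ d = G.bd
  isKernel_g : IsKernel g c
  /-- The action of `G₀` on `G` is the conjugation in `G₁`. -/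
  act_g : G.action.act ≫ g = brk e g
  exists_desc : ∀ {Z : C} (f : G.base ⟶ Z) (h : G.top ⟶ Z), G.action.act ≫ h = brk f h →
    ∃ t : obj ⟶ Z, e ≫ t = f ∧ g ≫ t = h

theorem CrossedModule.act_bd (G : CrossedModule C) :
    G.action.act ≫ G.bd = brk (𝟙 G.base) G.bd := by
  rw [G.precrossed, flatMap_conj]

theorem CrossedModule.brk_act (G : CrossedModule C) :
    flatMap G.bd (𝟙 G.top) ≫ G.action.act = brk (𝟙 G.top) (𝟙 G.top) :=
  G.peiffer

theorem CrossedModule.nonempty_realization (G : CrossedModule C) : Nonempty (Realization G) := by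
  obtain ⟨Q, q, c, hq, hw, hdesc, hc, hk⟩ := exists_semidirect G.action
  obtain ⟨d, hd⟩ := hdesc (coprod.desc (𝟙 _) G.bd) (by
    rw [Category.assoc, coprod.inr_desc, G.act_bd, brk])
  have hq' : coprod.desc (coprod.inl ≫ q) (coprod.inr ≫ q) = q := by ext <;> simp
  exact ⟨{
    obj := Q
    e := coprod.inl ≫ q
    g := coprod.inr ≫ q
    d := d
    c := c
    e_d := by rw [Category.assoc, hd, coprod.inl_desc]
    e_c := by rw [Category.assoc, hc, coprod.inl_desc]
    g_d := by rw [Category.assoc, hd, coprod.inr_desc]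
    isKernel_g := hk
    act_g := by rw [brk, hq', hw, Category.assoc]
    exists_desc := fun {Z} f h hfh => by
      obtain ⟨t, ht⟩ := hdesc (coprod.desc f h) (by
        rw [Category.assoc, coprod.inr_desc, hfh, brk])
      exact ⟨t, by rw [Category.assoc, ht, coprod.inl_desc],
        by rw [Category.assoc, ht, coprod.inr_desc]⟩ }⟩

namespace Realization

variable {G : CrossedModule C} (R : Realization G)

theorem g_c : R.g ≫ R.c = 0 := R.isKernel_g.w

theorem hom_ext {Z : C} {t t' : R.obj ⟶ Z} (h₁ : R.e ≫ t = R.e ≫ t') (h₂ : R.g ≫ t = R.g ≫ t') :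
    t = t' :=
  hom_ext_of_split R.isKernel_g R.e_c h₂ h₁

/-- The morphism `(a, b) ↦ g a ∘ (g b)⁻¹` from `G × G` to `G₁`, characterized by its values on
`(a, 0)` and `(a, a)` without reference to a groupoid structure. It exists by the Peiffer identity:
`G × G` is the semidirect product of the conjugation action of `G` on itself. -/
theorem exists_diff : ∃ φ : G.top ⨯ G.top ⟶ R.obj,
    prod.lift (𝟙 _) 0 ≫ φ = R.g ∧ prod.lift (𝟙 _) (𝟙 _) ≫ φ = G.bd ≫ R.e := by
  let r : G.top ⨿ G.top ⟶ G.top ⨯ G.top :=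
    coprod.desc (prod.lift (𝟙 _) (𝟙 _)) (prod.lift (𝟙 _) 0)
  have hr : IsRegularEpi r := by
    let F := Regular.strongEpiMonoFactorisation r
    have hF : F.e ≫ F.m = r := F.fac
    have : IsIso F.m := isIso_of_split (isKernel_prod_snd G.top G.top)
      (s := prod.lift (𝟙 _) (𝟙 _)) (by simp) F.m (coprod.inr ≫ F.e)
      (by rw [Category.assoc, hF]; simp [r]) (coprod.inl ≫ F.e)
      (by rw [Category.assoc, hF]; simp [r])
    rw [← hF]
    exact isRegularEpi_comp _ _
  obtain ⟨φ, hφ⟩ := (isKernel_kernel r).isCokernel.exists_desc (coprod.desc (G.bd ≫ R.e) R.g) (by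
    have h := kernel.condition r
    have h₂ : kernel.ι r ≫ coprod.desc (𝟙 _) 0 = 0 := by
      have : r ≫ prod.snd = coprod.desc (𝟙 _) 0 := by ext <;> simp [r]
      rw [← this, ← Category.assoc, h, zero_comp]
    obtain ⟨t, ht⟩ := (isKernel_flatι _ _).exists_lift _ h₂
    have h₁ : t ≫ brk (𝟙 G.top) (𝟙 G.top) = 0 := by
      have : r ≫ prod.fst = coprod.desc (𝟙 _) (𝟙 _) := by ext <;> simp [r]
      rw [brk, ← Category.assoc, ht, ← this, ← Category.assoc, h, zero_comp]
    have h₃ : brk (G.bd ≫ R.e) R.g = brk (𝟙 G.top) (𝟙 G.top) ≫ R.g := by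
      rw [← G.brk_act, Category.assoc, R.act_g, flatMap_brk, Category.id_comp]
    rw [← ht, Category.assoc]
    change t ≫ brk (G.bd ≫ R.e) R.g = 0
    rw [h₃, ← Category.assoc, h₁, zero_comp])
  refine ⟨φ, ?_, ?_⟩
  · have : prod.lift (𝟙 _) 0 = coprod.inr ≫ r := by simp [r]
    rw [this, Category.assoc, hφ, coprod.inr_desc]
  · have : prod.lift (𝟙 _) (𝟙 _) = coprod.inl ≫ r := by simp [r]
    rw [this, Category.assoc, hφ, coprod.inl_desc]

/-- The morphism `(a, b) ↦ g a ∘ (g b)⁻¹`, composed in diagrammatic order. -/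
noncomputable def diff : G.top ⨯ G.top ⟶ R.obj := R.exists_diff.choose

theorem diff_left : prod.lift (𝟙 _) 0 ≫ R.diff = R.g := R.exists_diff.choose_spec.1

theorem diff_diag : prod.lift (𝟙 _) (𝟙 _) ≫ R.diff = G.bd ≫ R.e := R.exists_diff.choose_spec.2

/-- The morphism `b ↦ (g b)⁻¹` (an inverse in the groupoid, not in the object `G₁`). -/
noncomputable def h : G.top ⟶ R.obj := prod.lift 0 (𝟙 _) ≫ R.diff

theorem diff_left' {T : C} (x : T ⟶ G.top) : prod.lift x 0 ≫ R.diff = x ≫ R.g := by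
  rw [← R.diff_left, ← Category.assoc]; congr 1; ext <;> simp

theorem diff_right' {T : C} (x : T ⟶ G.top) : prod.lift 0 x ≫ R.diff = x ≫ R.h := by
  rw [h, ← Category.assoc]; congr 1; ext <;> simp

theorem diff_diag' {T : C} (x : T ⟶ G.top) : prod.lift x x ≫ R.diff = x ≫ G.bd ≫ R.e := by
  rw [← R.diff_diag, ← Category.assoc]; congr 1; ext <;> simp

theorem prod_ext_diag {X W : C} {F F' : X ⨯ X ⟶ W}
    (h₁ : prod.lift (𝟙 X) 0 ≫ F = prod.lift (𝟙 X) 0 ≫ F')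
    (h₂ : prod.lift (𝟙 X) (𝟙 X) ≫ F = prod.lift (𝟙 X) (𝟙 X) ≫ F') : F = F' :=
  hom_ext_of_split (isKernel_prod_snd X X) (by simp) h₁ h₂

theorem diff_d : R.diff ≫ R.d = prod.fst ≫ G.bd := by
  apply prod_ext_diag
  · rw [← Category.assoc, R.diff_left, R.g_d, prod.lift_fst_assoc, Category.id_comp]
  · rw [← Category.assoc, R.diff_diag, Category.assoc, R.e_d, prod.lift_fst_assoc,
      Category.id_comp, Category.comp_id]

theorem diff_c : R.diff ≫ R.c = prod.snd ≫ G.bd := by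
  apply prod_ext_diag
  · rw [← Category.assoc, R.diff_left, R.g_c, prod.lift_snd_assoc, zero_comp]
  · rw [← Category.assoc, R.diff_diag, Category.assoc, R.e_c, prod.lift_snd_assoc,
      Category.id_comp, Category.comp_id]

theorem h_d : R.h ≫ R.d = 0 := by
  rw [h, Category.assoc, R.diff_d, prod.lift_fst_assoc, zero_comp]

theorem h_c : R.h ≫ R.c = G.bd := by
  rw [h, Category.assoc, R.diff_c, prod.lift_snd_assoc, Category.id_comp]

/-- `diff` exhibits `G × G` as the pullback of `c` along `∂`. -/
theorem exists_diff_eq {T : C} (x : T ⟶ R.obj) (b : T ⟶ G.top) (hxb : x ≫ R.c = b ≫ G.bd) :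
    ∃ a : T ⟶ G.top, prod.lift a b ≫ R.diff = x := by
  let t : G.top ⨯ G.top ⟶ pullback R.c G.bd := pullback.lift R.diff prod.snd R.diff_c
  have : IsIso t := by
    refine SemiAbelian.split_short_five (prod.lift (𝟙 G.top) 0) prod.snd
      (prod.lift (𝟙 G.top) (𝟙 G.top)) _ (pullback.snd R.c G.bd)
      (pullback.lift (G.bd ≫ R.e) (𝟙 G.top) (by
        rw [Category.assoc, R.e_c, Category.comp_id, Category.id_comp])) (𝟙 _) t (𝟙 _)
      (isKernel_prod_snd _ _) (by simp) (isKernel_pullback_snd R.c G.bd R.isKernel_g) (by simp)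
      ?_ ?_ ?_ inferInstance inferInstance
    · ext <;> simp [t, R.diff_left]
    · simp [t]
    · ext <;> simp [t, R.diff_diag]
  have h := IsIso.inv_hom_id t
  have h₁ : inv t ≫ R.diff = pullback.fst _ _ := by
    rw [IsIso.inv_comp_eq, pullback.lift_fst]
  have h₂ : inv t ≫ prod.snd = pullback.snd R.c G.bd := by
    rw [IsIso.inv_comp_eq, pullback.lift_snd]
  refine ⟨pullback.lift x b hxb ≫ inv t ≫ prod.fst, ?_⟩
  have : prod.lift (pullback.lift x b hxb ≫ inv t ≫ prod.fst) b =
      pullback.lift x b hxb ≫ inv t := by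
    ext <;> simp [h₂]
  rw [this, Category.assoc, h₁, pullback.lift_fst]

/-- The kernel of `∂` is central, so that subtraction `θ (a, k) = a - k` of its elements is a
morphism; on pairs `(k, b)` with `k` in this kernel, `diff` is `h (b - k)`. -/
theorem exists_sub : ∃ θ : G.top ⨯ kernel G.bd ⟶ G.top,
    (∀ {T : C} (x : T ⟶ G.top), prod.lift x 0 ≫ θ = x) ∧
    (∀ {T : C} (k : T ⟶ kernel G.bd), prod.lift (k ≫ kernel.ι G.bd) k ≫ θ = 0) ∧
    (∀ {T : C} (a : T ⟶ kernel G.bd) (b : T ⟶ G.top),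
      prod.lift (a ≫ kernel.ι G.bd) b ≫ R.diff = prod.lift b a ≫ θ ≫ R.h) := by
  have := R.isKernel_g.mono
  obtain ⟨θ, hθ⟩ := R.isKernel_g.exists_lift (prod.map (𝟙 _) (kernel.ι G.bd) ≫ R.diff) (by
    rw [Category.assoc, R.diff_c, prod.map_snd_assoc, kernel.condition, comp_zero])
  have h₁ : ∀ {T : C} (x : T ⟶ G.top), prod.lift x 0 ≫ θ = x := fun x => by
    rw [← cancel_mono R.g, Category.assoc, hθ, prod.lift_map_assoc, zero_comp, Category.comp_id,
      R.diff_left']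
  have h₂ : ∀ {T : C} (k : T ⟶ kernel G.bd), prod.lift (k ≫ kernel.ι G.bd) k ≫ θ = 0 :=
    fun k => by
      rw [← cancel_mono R.g, Category.assoc, hθ, prod.lift_map_assoc, Category.comp_id,
        R.diff_diag', Category.assoc, kernel.condition_assoc]
      simp
  refine ⟨θ, h₁, h₂, fun {T} a b => ?_⟩
  have key : prod.map (kernel.ι G.bd) (𝟙 _) ≫ R.diff =
      prod.lift prod.snd prod.fst ≫ θ ≫ R.h := by
    refine hom_ext_of_split (isKernel_prod_fst (kernel G.bd) G.top)
      (s := prod.lift (𝟙 _) (kernel.ι G.bd)) (by simp) ?_ ?_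
    · rw [prod.lift_map_assoc, ← Category.assoc, prod.comp_lift, prod.lift_fst, prod.lift_snd,
        ← Category.assoc, h₁, zero_comp, Category.comp_id, Category.id_comp]
      rfl
    · have := h₂ (𝟙 (kernel G.bd))
      rw [Category.id_comp] at this
      rw [prod.lift_map_assoc, ← Category.assoc, prod.comp_lift, prod.lift_fst, prod.lift_snd,
        ← Category.assoc, this, zero_comp, Category.comp_id, Category.id_comp, R.diff_diag',
        kernel.condition_assoc, zero_comp]
  have := prod.lift a b ≫= key
  rwa [prod.lift_map_assoc, Category.comp_id, ← Category.assoc, prod.comp_lift, prod.lift_fst,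
    prod.lift_snd] at this

/-- The morphism `h` is monic: subtracting an element of its kernel changes nothing in `G`, and
`a - a = 0`. -/
theorem mono_h : Mono R.h := by
  obtain ⟨θ, h₁, h₂, h₃⟩ := R.exists_sub
  refine mono_of_eq_zero _ fun {T} t ht => ?_
  -- the kernel `L` of `h` lies in the kernel of `∂`, and subtracting its elements does nothing
  obtain ⟨l, hl⟩ := (isKernel_kernel G.bd).exists_lift (kernel.ι R.h)
    (by rw [← R.h_c, kernel.condition_assoc, zero_comp])
  have := R.isKernel_g.mono
  have key : prod.map (𝟙 G.top) (kernel.ι R.h) ≫ R.diff = prod.fst ≫ R.g := by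
    apply prod_hom_ext
    · rw [prod.lift_map_assoc, zero_comp, Category.comp_id, R.diff_left', prod.lift_fst_assoc]
    · rw [prod.lift_map_assoc, zero_comp, Category.id_comp, R.diff_right', kernel.condition,
        prod.lift_fst_assoc, zero_comp]
  have hzero : kernel.ι R.h = 0 := by
    have := prod.lift (kernel.ι R.h) (𝟙 _) ≫= key
    rw [prod.lift_map_assoc, Category.comp_id, Category.id_comp, R.diff_diag',
      prod.lift_fst_assoc, ← hl, Category.assoc, kernel.condition_assoc, zero_comp, comp_zero,
      hl] at this
    rw [← cancel_mono R.g, ← this, zero_comp]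
  obtain ⟨t', rfl⟩ := (isKernel_kernel R.h).exists_lift t ht
  rw [hzero, comp_zero]

/-- The kernel of the domain map `d` is `h`. Given `t` with `d t = 0`, locally `c t = ∂ b`, so
`t = diff (a, b)` with `∂ a = 0`, and `exists_sub` puts `t` in the image of `h`. -/
theorem isKernel_h : IsKernel R.h R.d := by
  have := R.mono_h
  refine IsKernel.of_exists_lift R.h_d fun {T} t ht => ?_
  obtain ⟨θ, -, -, hθ⟩ := R.exists_sub
  -- `d` and `c` agree after the cokernel `q` of `∂`
  obtain ⟨Q, q, hq, huv, hloc⟩ := exists_quotient (coprod.desc (𝟙 G.base) (0 : G.top ⟶ G.base))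
    (coprod.desc (𝟙 G.base) G.bd) coprod.inl (by simp) (by simp)
  have hbd : G.bd ≫ q = 0 := by simpa using (coprod.inr ≫= huv).symm
  have hdc : R.c ≫ q = R.d ≫ q := by
    apply R.hom_ext
    · rw [← Category.assoc, ← Category.assoc, R.e_c, R.e_d]
    · rw [← Category.assoc, ← Category.assoc, R.g_c, R.g_d, hbd, zero_comp]
  obtain ⟨T', e, z, he, h₁, h₂⟩ := hloc 0 (t ≫ R.c)
    (by rw [zero_comp, Category.assoc, hdc, ← Category.assoc, ht, zero_comp])
  obtain ⟨z', hz'⟩ := (isKernel_flatι _ _).exists_lift z (by rw [h₁, comp_zero])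
  obtain ⟨a, ha⟩ := R.exists_diff_eq (e ≫ t) (z' ≫ G.action.act) (by
    rw [Category.assoc, ← h₂, ← hz', Category.assoc, Category.assoc, G.act_bd, brk])
  obtain ⟨a', rfl⟩ := (isKernel_kernel G.bd).exists_lift a (by
    have := ha =≫ R.d
    rwa [Category.assoc, R.diff_d, prod.lift_fst_assoc, Category.assoc, ht, comp_zero] at this)
  refine exists_fac_of_cover e R.h (prod.lift (z' ≫ G.action.act) a' ≫ θ) t ?_
  rw [Category.assoc, ← hθ, ha]

theorem hom_ext' {Z : C} {t t' : R.obj ⟶ Z} (h₁ : R.e ≫ t = R.e ≫ t')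
    (h₂ : R.h ≫ t = R.h ≫ t') : t = t' :=
  hom_ext_of_split R.isKernel_h R.e_d h₂ h₁

end Realization

/-! ### The groupoid of a crossed module -/

namespace Realization

variable {G : CrossedModule C} (R : Realization G)

/-- The object of triples `(x, y, z)` with `c x = c y` and `d y = d z`. -/
noncomputable abbrev Triples : C :=
  pullback (pullback.snd R.c R.c) (pullback.fst R.d R.d)

/-- The element of `Triples` with components `x`, `y` and `z`. -/
noncomputable abbrev triple {T : C} (x y z : T ⟶ R.obj) (h₁ : x ≫ R.c = y ≫ R.c)
    (h₂ : y ≫ R.d = z ≫ R.d) : T ⟶ R.Triples :=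
  pullback.lift (pullback.lift x y h₁) (pullback.lift y z h₂) (by simp)

theorem comp_triple {T T' : C} (t : T' ⟶ T) (x y z : T ⟶ R.obj) (h₁ : x ≫ R.c = y ≫ R.c)
    (h₂ : y ≫ R.d = z ≫ R.d) : t ≫ R.triple x y z h₁ h₂ =
      R.triple (t ≫ x) (t ≫ y) (t ≫ z) (by simp [h₁]) (by simp [h₂]) := by
  ext <;> simp

theorem comp_triple_assoc {T T' W : C} (t : T' ⟶ T) (x y z : T ⟶ R.obj) (h₁ : x ≫ R.c = y ≫ R.c)
    (h₂ : y ≫ R.d = z ≫ R.d) (F : R.Triples ⟶ W) : t ≫ R.triple x y z h₁ h₂ ≫ F =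
      R.triple (t ≫ x) (t ≫ y) (t ≫ z) (by simp [h₁]) (by simp [h₂]) ≫ F :=
  (Category.assoc _ _ _).symm.trans (congrArg (· ≫ F) (R.comp_triple t x y z h₁ h₂))

/-- The degenerate triples `(x, y, y)` and `(y, y, z)` are jointly epic. -/
theorem triples_hom_ext {W : C} {F F' : R.Triples ⟶ W}
    (h₁ : ∀ {T : C} (x y : T ⟶ R.obj) (h : x ≫ R.c = y ≫ R.c),
      R.triple x y y h rfl ≫ F = R.triple x y y h rfl ≫ F')
    (h₂ : ∀ {T : C} (y z : T ⟶ R.obj) (h : y ≫ R.d = z ≫ R.d),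
      R.triple y y z rfl h ≫ F = R.triple y y z rfl h ≫ F') : F = F' := by
  refine hom_ext_of_split_pullback (r := pullback.lift (𝟙 _) (𝟙 _) rfl)
    (s := pullback.lift (𝟙 _) (𝟙 _) rfl) (by simp) (by simp) ?_ ?_
  · have h := h₁ (pullback.fst R.c R.c) (pullback.snd R.c R.c) pullback.condition
    have e : R.triple (pullback.fst R.c R.c) (pullback.snd R.c R.c) (pullback.snd R.c R.c)
        pullback.condition rfl = pullback.lift (𝟙 _)
          (pullback.snd R.c R.c ≫ pullback.lift (𝟙 _) (𝟙 _) rfl) (by simp) := by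
      ext <;> simp
    rwa [e] at h
  · have h := h₂ (pullback.fst R.d R.d) (pullback.snd R.d R.d) pullback.condition
    have e : R.triple (pullback.fst R.d R.d) (pullback.fst R.d R.d) (pullback.snd R.d R.d)
        rfl pullback.condition = pullback.lift
          (pullback.fst R.d R.d ≫ pullback.lift (𝟙 _) (𝟙 _) rfl) (𝟙 _) (by simp) := by
      ext <;> simp
    rwa [e] at h

/-- The kernels `g` of `c` and `h` of `d` commute in the sense of Huq by means of `diff`, so that
the kernel pairs of `c` and `d` commute in the sense of Smith. The morphism `Φ (x, y, z)` is to be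
thought of as `x ∘ y⁻¹ ∘ z`. -/
theorem exists_connector (hHS : HuqImpliesSmith C) : ∃ Φ : R.Triples ⟶ R.obj,
    (∀ {T : C} (x y z : T ⟶ R.obj) (h₁ h₂), y = z → R.triple x y z h₁ h₂ ≫ Φ = x) ∧
    (∀ {T : C} (x y z : T ⟶ R.obj) (h₁ h₂), x = y → R.triple x y z h₁ h₂ ≫ Φ = z) := by
  let hR := IsKernelPair.equivalenceRelation R.c (pullback.fst R.c R.c) (pullback.snd R.c R.c)
    (pullback.isLimit _ _) (IsKernelPair.of_hasPullback _)
  let hS := IsKernelPair.equivalenceRelation R.d (pullback.fst R.d R.d) (pullback.snd R.d R.d)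
    (pullback.isLimit _ _) (IsKernelPair.of_hasPullback _)
  obtain ⟨a, ha⟩ := R.isKernel_g.exists_lift
    (kernel.ι (pullback.snd R.c R.c) ≫ pullback.fst R.c R.c)
    (by rw [Category.assoc, pullback.condition, kernel.condition_assoc, zero_comp])
  obtain ⟨b, hb⟩ := R.isKernel_h.exists_lift
    (kernel.ι (pullback.snd R.d R.d) ≫ pullback.fst R.d R.d)
    (by rw [Category.assoc, pullback.condition, kernel.condition_assoc, zero_comp])
  obtain ⟨Φ, h₁, h₂⟩ := hHS hR hS ⟨prod.map a b ≫ R.diff, by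
      rw [prod.lift_map_assoc, zero_comp, Category.id_comp, R.diff_left', ha], by
      rw [prod.lift_map_assoc, zero_comp, Category.id_comp, R.diff_right', hb]⟩
  have hRr : hR.r = pullback.lift (𝟙 _) (𝟙 _) rfl := by
    ext
    · rw [hR.reflexivity₁, pullback.lift_fst]
    · rw [hR.reflexivity₂, pullback.lift_snd]
  have hSr : hS.r = pullback.lift (𝟙 _) (𝟙 _) rfl := by
    ext
    · rw [hS.reflexivity₁, pullback.lift_fst]
    · rw [hS.reflexivity₂, pullback.lift_snd]
  refine ⟨Φ, fun {T} x y z h hz hyz => ?_, fun {T} x y z hx h hxy => ?_⟩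
  · subst hyz
    have h' := pullback.lift x y h ≫= h₁
    rw [pullback.lift_fst, ← Category.assoc] at h'
    refine Eq.trans ?_ h'
    congr 1
    ext <;> simp [hSr]
  · subst hxy
    have h' := pullback.lift x z h ≫= h₂
    rw [pullback.lift_snd, ← Category.assoc] at h'
    refine Eq.trans ?_ h'
    congr 1
    ext <;> simp [hRr]

/-- The groupoid of a crossed module: the composite of `f` and `f'` is `Φ (f, 1, f')` and the
inverse of `f` is `Φ (1, f, 1)`. The inverse map exchanges `g` and `h`. -/
theorem exists_groupoid (hHS : HuqImpliesSmith C) :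
    ∃ A : InternalGroupoid R.d R.c R.e,
      R.e ≫ A.inv = R.e ∧ R.g ≫ A.inv = R.h ∧ R.h ≫ A.inv = R.g := by
  obtain ⟨Φ, h₁, h₂⟩ := R.exists_connector hHS
  have Φ_d : Φ ≫ R.d = (pullback.fst _ _ ≫ pullback.fst _ _) ≫ R.d := by
    apply R.triples_hom_ext
    · intro T x y h
      rw [← Category.assoc, h₁ _ _ _ _ _ rfl]; simp
    · intro T y z h
      rw [← Category.assoc, h₂ _ _ _ _ _ rfl]; simp [h]
  have Φ_c : Φ ≫ R.c = (pullback.snd _ _ ≫ pullback.snd _ _) ≫ R.c := by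
    apply R.triples_hom_ext
    · intro T x y h
      rw [← Category.assoc, h₁ _ _ _ _ _ rfl]; simp [h]
    · intro T y z h
      rw [← Category.assoc, h₂ _ _ _ _ _ rfl]; simp
  let m : pullback R.c R.d ⟶ R.obj := R.triple (pullback.fst R.c R.d)
    (pullback.fst R.c R.d ≫ R.c ≫ R.e) (pullback.snd R.c R.d) (by simp [R.e_c])
    (by simp [R.e_d, pullback.condition]) ≫ Φ
  let i : R.obj ⟶ R.obj := R.triple (R.c ≫ R.e) (𝟙 _) (R.d ≫ R.e) (by simp [R.e_c])
    (by simp [R.e_d]) ≫ Φ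
  have comp_m : ∀ {T T' : C} (t : T' ⟶ T) (x y : T ⟶ R.obj) (h : x ≫ R.c = y ≫ R.d),
      t ≫ pullback.lift x y h ≫ m = pullback.lift (t ≫ x) (t ≫ y) (by simp [h]) ≫ m := by
    intro T T' t x y h
    rw [← Category.assoc]
    congr 1
    ext <;> simp
  have m_left : ∀ {T : C} (x y : T ⟶ R.obj) (h : x ≫ R.c = y ≫ R.d), y = x ≫ R.c ≫ R.e →
      pullback.lift x y h ≫ m = x := by
    intro T x y h hy
    simp only [m]
    rw [comp_triple_assoc]
    refine (h₁ _ _ _ _ _ ?_).trans ?_ <;> simp [hy]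
  have m_right : ∀ {T : C} (x y : T ⟶ R.obj) (h : x ≫ R.c = y ≫ R.d), x = y ≫ R.d ≫ R.e →
      pullback.lift x y h ≫ m = y := by
    intro T x y h hx
    simp only [m]
    rw [comp_triple_assoc]
    refine (h₂ _ _ _ _ _ ?_).trans ?_ <;> simp [hx, reassoc_of% R.e_c]
  have m_d : m ≫ R.d = pullback.fst R.c R.d ≫ R.d := by
    simp only [m, Category.assoc, Φ_d]; simp
  have m_c : m ≫ R.c = pullback.snd R.c R.d ≫ R.c := by
    simp only [m, Category.assoc, Φ_c]; simp
  have i_d : i ≫ R.d = R.c := by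
    simp only [i, Category.assoc, Φ_d]; simp [R.e_d]
  have i_c : i ≫ R.c = R.d := by
    simp only [i, Category.assoc, Φ_c]; simp [R.e_c]
  have e_i : R.e ≫ i = R.e := by
    simp only [i]
    rw [comp_triple_assoc]
    refine (h₁ _ _ _ _ _ ?_).trans ?_ <;> simp [reassoc_of% R.e_c, reassoc_of% R.e_d]
  clear_value m
  -- `(a, b) ↦ g a ∘ (g b)⁻¹` is the composite of `g a` and `h b`
  have m_gh : ∀ {T : C} (x y : T ⟶ R.obj) (h : x ≫ R.c = y ≫ R.d) (a : T ⟶ G.top),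
      x = a ≫ R.g → y = a ≫ R.h → pullback.lift x y h ≫ m = a ≫ G.bd ≫ R.e := by
    rintro T _ _ h a rfl rfl
    have key : pullback.lift (prod.fst ≫ R.g) (prod.snd ≫ R.h) (by simp [R.g_c, R.h_d]) ≫ m =
        R.diff := by
      apply prod_hom_ext
      · rw [R.diff_left, comp_m]
        refine (m_left _ _ _ ?_).trans ?_ <;> simp [reassoc_of% R.g_c]
      · rw [R.diff_right', Category.id_comp, comp_m]
        refine (m_right _ _ _ ?_).trans ?_ <;> simp [reassoc_of% R.h_d]
    rw [← R.diff_diag', ← key, ← Category.assoc]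
    congr 1
    ext <;> simp
  -- `Φ (0, g a, g a ∘ (g b)⁻¹) = h b`, an instance of which is `i (g a) = h a`
  have g_i : R.g ≫ i = R.h := by
    have key : R.triple 0 (prod.fst ≫ R.g) R.diff (by simp [R.g_c])
        (by simp [R.g_d, R.diff_d]) ≫ Φ = prod.snd ≫ R.h := by
      apply prod_hom_ext
      · rw [comp_triple_assoc]
        refine (h₁ _ _ _ _ _ ?_).trans ?_ <;> simp [R.diff_left]
      · rw [comp_triple_assoc]
        refine (h₂ _ _ _ _ _ ?_).trans ?_ <;> simp [R.diff_right']
    have h := prod.lift (𝟙 _) (𝟙 _) ≫= key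
    rw [prod.lift_snd_assoc, Category.id_comp, comp_triple_assoc] at h
    refine Eq.trans ?_ h
    simp only [i]
    rw [comp_triple_assoc]
    congr 1
    ext <;> simp [R.diff_diag, reassoc_of% R.g_c, reassoc_of% R.g_d]
  -- `Φ (g a ∘ (g b)⁻¹, h b, 0) = g a`, an instance of which is `i (h a) = g a`
  have h_i : R.h ≫ i = R.g := by
    have key : R.triple R.diff (prod.snd ≫ R.h) 0 (by simp [R.h_c, R.diff_c])
        (by simp [R.h_d]) ≫ Φ = prod.fst ≫ R.g := by
      apply prod_hom_ext
      · rw [comp_triple_assoc]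
        refine (h₁ _ _ _ _ _ ?_).trans ?_ <;> simp [R.diff_left]
      · rw [comp_triple_assoc]
        refine (h₂ _ _ _ _ _ ?_).trans ?_ <;> simp [R.diff_right']
    have h := prod.lift (𝟙 _) (𝟙 _) ≫= key
    rw [prod.lift_fst_assoc, Category.id_comp, comp_triple_assoc] at h
    refine Eq.trans ?_ h
    simp only [i]
    rw [comp_triple_assoc]
    congr 1
    ext <;> simp [R.diff_diag, reassoc_of% R.h_c, reassoc_of% R.h_d]
  refine ⟨{
    e_d := R.e_d
    e_c := R.e_c
    m := m
    m_d := m_d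
    m_c := m_c
    id_m := m_right _ _ _ (by simp)
    m_id := m_left _ _ _ (by simp)
    m_assoc := ?_
    inv := i
    inv_d := i_d
    inv_c := i_c
    m_inv := ?_
    inv_m := ?_ }, e_i, g_i, h_i⟩
  · intro T x y z hxy hyz
    -- triples `(x, y, z)` are generated by those with `z = 1` and those with `x = y = 1`
    let P := pullback (pullback.snd R.c R.d ≫ R.c) R.d
    have key : (pullback.lift (pullback.fst _ _ ≫ m) (pullback.snd _ _) (by
          rw [Category.assoc, m_c, pullback.condition]) ≫ m : P ⟶ R.obj) =
        pullback.lift (pullback.fst _ _ ≫ pullback.fst R.c R.d)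
          (pullback.lift (pullback.fst _ _ ≫ pullback.snd R.c R.d) (pullback.snd _ _)
            (by rw [Category.assoc, pullback.condition]) ≫ m)
          (by rw [Category.assoc, Category.assoc, m_d, pullback.lift_fst_assoc,
            pullback.condition, Category.assoc]) ≫ m := by
      refine hom_ext_of_split_pullback
        (r := pullback.lift R.e R.e (by rw [R.e_c, R.e_d])) (s := R.e)
        (by simp [R.e_c]) R.e_d ?_ ?_
      · rw [comp_m, comp_m]
        refine (m_left _ _ _ ?_).trans ?_
        · simp [reassoc_of% m_c]
        · rw [pullback.lift_fst_assoc, Category.id_comp]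
          have e : pullback.lift (pullback.fst R.c R.d) (pullback.snd R.c R.d)
              pullback.condition = 𝟙 _ := by ext <;> simp
          refine Eq.trans (Category.id_comp m).symm (congrArg (· ≫ m) (e.symm.trans ?_))
          ext
          · simp
          · simp only [pullback.lift_snd, comp_m]
            refine (Eq.trans (m_left _ _ _ ?_) ?_).symm <;> simp
      · rw [comp_m, comp_m]
        have e : pullback.lift R.e R.e (by rw [R.e_c, R.e_d]) ≫ m = R.e :=
          m_left _ _ _ (by rw [reassoc_of% R.e_c])
        refine (m_right _ _ _ ?_).trans (Eq.symm ((m_right _ _ _ ?_).trans ?_))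
        · simp [e]
        · simp [reassoc_of% m_d, reassoc_of% R.e_d]
        · rw [comp_m]
          refine (m_right _ _ _ ?_).trans ?_ <;> simp
    have h := (pullback.lift (pullback.lift x y hxy) z (by
      rw [pullback.lift_snd_assoc, hyz]) : T ⟶ P) ≫= key
    rw [comp_m, comp_m] at h
    refine Eq.trans ?_ (h.trans ?_)
    · congr 1
      ext <;> simp
    · congr 1
      ext
      · simp
      · simp only [pullback.lift_snd, comp_m]
        congr 1
        ext <;> simp
  · apply R.hom_ext
    · rw [reassoc_of% R.e_d, comp_m]
      refine (m_left _ _ _ ?_).trans ?_ <;> simp [e_i, reassoc_of% R.e_c]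
    · rw [reassoc_of% R.g_d, comp_m]
      refine (m_gh _ _ _ (𝟙 _) ?_ ?_).trans ?_ <;> simp [g_i]
  · apply R.hom_ext'
    · rw [reassoc_of% R.e_c, comp_m]
      refine (m_left _ _ _ ?_).trans ?_ <;> simp [e_i, reassoc_of% R.e_c]
    · rw [reassoc_of% R.h_c, comp_m]
      refine (m_gh _ _ _ (𝟙 _) ?_ ?_).trans ?_ <;> simp [h_i]

end Realization

/-! ### Identity butterflies -/

theorem InternalGroupoid.lift_m_left {G₁ G₀ : C} {d c : G₁ ⟶ G₀} {e : G₀ ⟶ G₁}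
    (A : InternalGroupoid d c e) {T : C} (x y : T ⟶ G₁) (h : x ≫ c = y ≫ d)
    (hy : y = x ≫ c ≫ e) : pullback.lift x y h ≫ A.m = x := by
  have := x ≫= A.m_id
  refine Eq.trans ?_ (this.trans (Category.comp_id x))
  rw [← Category.assoc]
  congr 1
  ext <;> simp [hy]

theorem InternalGroupoid.lift_m_right {G₁ G₀ : C} {d c : G₁ ⟶ G₀} {e : G₀ ⟶ G₁}
    (A : InternalGroupoid d c e) {T : C} (x y : T ⟶ G₁) (h : x ≫ c = y ≫ d)
    (hx : x = y ≫ d ≫ e) : pullback.lift x y h ≫ A.m = y := by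
  have := y ≫= A.id_m
  refine Eq.trans ?_ (this.trans (Category.comp_id y))
  rw [← Category.assoc]
  congr 1
  ext <;> simp [hx]

theorem InternalGroupoid.lift_m_inv {G₁ G₀ : C} {d c : G₁ ⟶ G₀} {e : G₀ ⟶ G₁}
    (A : InternalGroupoid d c e) {T : C} (x y : T ⟶ G₁) (h : x ≫ c = y ≫ d)
    (hx : y = x ≫ A.inv) : pullback.lift x y h ≫ A.m = x ≫ d ≫ e := by
  have := x ≫= A.m_inv
  rw [← Category.assoc] at this
  refine Eq.trans ?_ this
  congr 1
  ext <;> simp [hx]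

/-- In an internal groupoid, elements of `G₁` act on the kernel of `c` through their domain. -/
theorem InternalGroupoid.brk_eq {G₁ G₀ X : C} {d c : G₁ ⟶ G₀} {e : G₀ ⟶ G₁}
    (A : InternalGroupoid d c e) (g : X ⟶ G₁) (hg : g ≫ c = 0) :
    brk (𝟙 G₁) g = brk (d ≫ e) g := by
  -- `m` and the first projection agree on the kernel of the second projection, where the bracket
  -- of `s : f ↦ (1, f)` and `k : x ↦ (g x, 1)` lies
  let s : G₁ ⟶ pullback c d := pullback.lift (d ≫ e) (𝟙 G₁) (by simp [A.e_c])
  let k : X ⟶ pullback c d := pullback.lift g 0 (by simp [hg])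
  have hsm : s ≫ A.m = 𝟙 G₁ := A.id_m
  have hkm : k ≫ A.m = g := A.lift_m_left _ _ _ (by rw [reassoc_of% hg, zero_comp])
  have h₀ : brk s k ≫ pullback.snd c d = 0 := by
    rw [brk_comp, pullback.lift_snd, pullback.lift_snd, brk_zero_right]
  have h₁ : brk s k ≫ pullback.fst c d = brk (d ≫ e) g := by
    rw [brk_comp, pullback.lift_fst, pullback.lift_fst]
  have h : brk s k = pullback.lift (brk s k ≫ pullback.fst c d) 0
      (by rw [Category.assoc, pullback.condition, ← Category.assoc, h₀, zero_comp]) := by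
    ext <;> simp [h₀]
  calc brk (𝟙 G₁) g = brk s k ≫ A.m := by rw [brk_comp, hsm, hkm]
    _ = brk s k ≫ pullback.fst c d := by
      rw [h]
      refine (A.lift_m_left _ _ _ ?_).trans (pullback.lift_fst _ _ _).symm
      rw [Category.assoc, pullback.condition_assoc, reassoc_of% h₀, zero_comp]
    _ = brk (d ≫ e) g := h₁

/-- Every crossed module has an identity butterfly. Equivariance of `ι = g` is `brk_eq`, and that of
`κ = h` follows from it by applying the inverse map. -/
theorem CrossedModule.exists_ident (hHS : HuqImpliesSmith C) (G : CrossedModule C) :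
    ∃ I : Butterfly G G, Nonempty (Ident I) := by
  obtain ⟨R⟩ := G.nonempty_realization
  obtain ⟨A, hei, hgi, hhi⟩ := R.exists_groupoid hHS
  have hii : A.inv ≫ A.inv = 𝟙 _ := by
    apply R.hom_ext
    · rw [← Category.assoc, hei, hei, Category.comp_id]
    · rw [← Category.assoc, hgi, hhi, Category.comp_id]
  have hg := A.brk_eq R.g R.g_c
  have : IsSplitEpi R.c := ⟨⟨R.e, R.e_c⟩⟩
  let I : Butterfly G G := {
    E := R.obj
    κ := R.h
    ι := R.g
    σ := R.c
    ρ := R.d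
    κ_σ := R.h_c
    ι_ρ := R.g_d
    κ_ρ := R.h_d
    isKernel := R.isKernel_g
    isCokernel := R.isKernel_g.isCokernel
    κ_equivariant := by
      rw [flatMap_conj, ← hgi, reassoc_of% R.act_g]
      have h := flatMap A.inv (𝟙 G.top) ≫= (hg =≫ A.inv)
      rw [brk_comp, brk_comp, flatMap_brk, flatMap_brk, Category.id_comp, Category.id_comp, hii,
        Category.assoc, hei, reassoc_of% A.inv_d] at h
      rw [h, brk_comp, flatMap_brk, hei, Category.id_comp]
    ι_equivariant := by
      rw [flatMap_conj, R.act_g, flatMap_brk, Category.id_comp, hg] }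
  exact ⟨I, ⟨{
    e := R.e
    w := by
      have h := R.act_g
      rw [brk] at h
      simp only [Category.assoc, coprod.inr_desc]
      exact h.symm
    isCoequalizer := ⟨Cofork.IsColimit.mk' _ fun s => by
      have hs := s.condition
      have ht := R.exists_desc (coprod.inl ≫ s.π) (coprod.inr ≫ s.π) (by
        rw [brk, ← Category.assoc, ← hs]
        congr 1
        ext <;> simp)
      refine ⟨ht.choose, ?_, fun {m} hm => ?_⟩
      · ext
        · simpa using ht.choose_spec.1
        · simpa using ht.choose_spec.2
      · apply R.hom_ext
        · rw [ht.choose_spec.1, ← hm]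
          exact (coprod.inl_desc_assoc _ _ _).symm
        · rw [ht.choose_spec.2, ← hm]
          exact (coprod.inr_desc_assoc _ _ _).symm⟩
    groupoid := A
    κ_eq := hgi.symm }⟩⟩

/-! ### Morphisms of butterflies -/

/-- The short five lemma for morphisms of butterflies: pulling `σ` back along itself splits the
extension, the split case gives an isomorphism, and the regular epimorphism `σ` descends it. -/
theorem Butterfly.Hom.isIso_hom {H G : CrossedModule C} {E E' : Butterfly H G}
    (f : Butterfly.Hom E E') : IsIso f.hom := by
  have := E.isCokernel.isRegularEpi
  have := E'.isKernel.mono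
  let t : pullback E.σ E.σ ⟶ pullback E.σ E'.σ := pullback.lift (pullback.fst _ _)
    (pullback.snd _ _ ≫ f.hom) (by rw [Category.assoc, f.hom_σ, pullback.condition])
  have : IsIso t := by
    refine SemiAbelian.split_short_five _ (pullback.fst E.σ E.σ)
      (pullback.lift (𝟙 _) (𝟙 _) rfl) _ (pullback.fst E.σ E'.σ)
      (pullback.lift (𝟙 _) f.hom (by rw [f.hom_σ, Category.id_comp])) (𝟙 _) t (𝟙 _)
      (isKernel_pullback_fst _ _ E.isKernel) (by simp) (isKernel_pullback_fst _ _ E'.isKernel)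
      (by simp) ?_ ?_ ?_ inferInstance inferInstance
    · ext <;> simp [t, f.ι_hom]
    · simp [t]
    · ext <;> simp [t]
  have : IsRegularEpi (pullback.snd E.σ E.σ ≫ f.hom) := by
    have h : pullback.snd E.σ E.σ ≫ f.hom = t ≫ pullback.snd E.σ E'.σ := by simp [t]
    rw [h]
    exact isRegularEpi_comp _ _
  have : IsRegularEpi f.hom := isRegularEpi_of_comp (pullback.snd E.σ E.σ) f.hom
  have : Mono f.hom := by
    refine mono_of_eq_zero _ fun {T} x hx => ?_
    obtain ⟨a, rfl⟩ := E.isKernel.exists_lift x (by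
      rw [← f.hom_σ, ← Category.assoc, hx, zero_comp])
    rw [Category.assoc, f.ι_hom] at hx
    have : a = 0 := by rw [← cancel_mono E'.ι, hx, zero_comp]
    rw [this, zero_comp]
  exact isIso_of_mono_of_strongEpi _

/-- The isomorphism of butterflies underlying a morphism of butterflies. -/
noncomputable def Butterfly.Hom.iso {H G : CrossedModule C} {E E' : Butterfly H G}
    (f : E ⟶ E') : E ≅ E' :=
  have := Butterfly.Hom.isIso_hom f
  { hom := f
    inv := ⟨inv f.hom, by rw [IsIso.comp_inv_eq, f.κ_hom], by rw [IsIso.comp_inv_eq, f.ι_hom],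
      by rw [IsIso.inv_comp_eq, f.hom_σ], by rw [IsIso.inv_comp_eq, f.hom_ρ]⟩
    hom_inv_id := Butterfly.Hom.ext (IsIso.hom_inv_id f.hom)
    inv_hom_id := Butterfly.Hom.ext (IsIso.inv_hom_id f.hom) }

/-! ### Composition of butterflies -/

/-- Cokernels exist: the cokernel of `k` is the quotient of the graph with edges from `a` to
`a + k x`. -/
theorem exists_cokernel {K A : C} (k : K ⟶ A) : ∃ (Q : C) (q : A ⟶ Q), IsCokernel k q := by
  obtain ⟨Q, q, hq, huv, hloc⟩ := exists_quotient (coprod.desc (𝟙 A) (0 : K ⟶ A))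
    (coprod.desc (𝟙 A) k) coprod.inl (by simp) (by simp)
  have w : k ≫ q = 0 := by simpa using (coprod.inr ≫= huv).symm
  refine ⟨Q, q, w, ⟨CokernelCofork.IsColimit.ofπ' q w fun t ht => ?_⟩⟩
  have h := exists_desc_of_quotient hloc t (by ext <;> simp [ht])
  exact ⟨h.choose, h.choose_spec⟩

/-- Equivariance of `κ` for generalized elements `f` of `E`. -/
theorem Butterfly.κ_brk {H G : CrossedModule C} (E : Butterfly H G) {B : C} (f : B ⟶ E.E) :
    flatMap (f ≫ E.σ) (𝟙 H.top) ≫ H.action.act ≫ E.κ = brk f E.κ := by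
  have h := flatMap f (𝟙 H.top) ≫= E.κ_equivariant
  rwa [← Category.assoc, flatMap_comp, Category.comp_id, flatMap_conj, flatMap_brk,
    Category.comp_id, Category.id_comp] at h

/-- Equivariance of `ι` for generalized elements `f` of `E`. -/
theorem Butterfly.ι_brk {H G : CrossedModule C} (E : Butterfly H G) {B : C} (f : B ⟶ E.E) :
    flatMap (f ≫ E.ρ) (𝟙 G.top) ≫ G.action.act ≫ E.ι = brk f E.ι := by
  have h := flatMap f (𝟙 G.top) ≫= E.ι_equivariant
  rwa [← Category.assoc, flatMap_comp, Category.comp_id, flatMap_conj, flatMap_brk,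
    Category.comp_id, Category.id_comp] at h

section Composition

variable {H G K : CrossedModule C} (E : Butterfly H G) (E' : Butterfly G K)

/-- The morphism `⟨ι, κ'⟩` whose cokernel is the composite of `E` and `E'`. -/
noncomputable def Butterfly.middle : G.top ⟶ pullback E.ρ E'.σ :=
  pullback.lift E.ι E'.κ (by rw [E.ι_ρ, E'.κ_σ])

/-- The morphism `⟨ι, κ'⟩` is a normal monomorphism, being stable under conjugation. -/
theorem Butterfly.isKernel_middle {Q : C} {q : pullback E.ρ E'.σ ⟶ Q}
    (hq : IsCokernel (E.middle E') q) : IsKernel (E.middle E') q := by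
  have := E.isKernel.mono
  have : Mono (E.middle E') := by
    have : Mono (E.middle E' ≫ pullback.fst E.ρ E'.σ) := by
      rw [middle, pullback.lift_fst]; infer_instance
    exact mono_of_mono _ (pullback.fst E.ρ E'.σ)
  refine hq.isKernel_of_conj
    (flatMap (pullback.fst E.ρ E'.σ ≫ E.ρ) (𝟙 G.top) ≫ G.action.act) ?_
  ext
  · simp only [middle, brk_comp, Category.assoc, pullback.lift_fst, Category.id_comp, E.ι_brk]
  · simp only [middle, brk_comp, Category.assoc, pullback.lift_snd, Category.id_comp,
      pullback.condition, E'.κ_brk]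

/-- The composite of two butterflies exists. The point is that its leg `ι` is a kernel of its leg
`σ`, which uses the normality of `⟨ι, κ'⟩`. -/
theorem Butterfly.exists_comp : ∃ F : Butterfly H K, Nonempty (Comp E E' F) := by
  have := E.isCokernel.isRegularEpi
  have := E'.isCokernel.isRegularEpi
  have := E.isKernel.mono
  have := E'.isKernel.mono
  obtain ⟨Q, q, hq⟩ := exists_cokernel (E.middle E')
  have hk := E.isKernel_middle E' hq
  have := hq.isRegularEpi
  obtain ⟨σ, hσ⟩ := hq.exists_desc (pullback.fst E.ρ E'.σ ≫ E.σ) (by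
    simp [middle, E.isKernel.w])
  obtain ⟨ρ, hρ⟩ := hq.exists_desc (pullback.snd E.ρ E'.σ ≫ E'.ρ) (by
    simp [middle, E'.κ_ρ])
  let κ₀ : H.top ⟶ pullback E.ρ E'.σ := pullback.lift E.κ 0 (by rw [E.κ_ρ, zero_comp])
  let ι₀ : K.top ⟶ pullback E.ρ E'.σ := pullback.lift 0 E'.ι (by rw [E'.isKernel.w, zero_comp])
  have hσ' : IsRegularEpi σ := by
    have : IsRegularEpi (q ≫ σ) := by
      rw [hσ]
      exact isRegularEpi_comp _ _
    exact isRegularEpi_of_comp q σ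
  have hιmono : Mono (ι₀ ≫ q) := by
    refine mono_of_eq_zero _ fun {T} t ht => ?_
    obtain ⟨a, ha⟩ := hk.exists_lift (t ≫ ι₀) (by rw [Category.assoc, ht])
    have ha₁ : a = 0 := by
      have := ha =≫ pullback.fst _ _
      simp only [middle, ι₀, Category.assoc, pullback.lift_fst, comp_zero] at this
      rw [← cancel_mono E.ι, this, zero_comp]
    have := ha =≫ pullback.snd _ _
    simp only [ι₀, ha₁, zero_comp, Category.assoc, pullback.lift_snd] at this
    rw [← cancel_mono E'.ι, ← this, zero_comp]
  have hιker : IsKernel (ι₀ ≫ q) σ := by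
    refine IsKernel.of_exists_lift (by rw [Category.assoc, hσ]; simp [ι₀]) fun {T} t ht => ?_
    -- the kernel of `σ` is covered by the elements `(a, y)` of `G ×_{G₀} E'`, a split extension
    let S := pullback G.bd E'.σ
    let u : S ⟶ pullback E.ρ E'.σ := pullback.lift (pullback.fst _ _ ≫ E.ι) (pullback.snd _ _)
      (by rw [Category.assoc, E.ι_ρ, pullback.condition])
    have hiso : IsIso (pullback.fst (u ≫ q) (ι₀ ≫ q)) := by
      refine isIso_of_split (isKernel_pullback_fst G.bd E'.σ E'.isKernel)
        (s := pullback.lift (𝟙 _) E'.κ (by rw [E'.κ_σ, Category.id_comp])) (by simp) _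
        (pullback.lift (pullback.lift 0 E'.ι (by rw [E'.isKernel.w, zero_comp])) (𝟙 _) ?_)
        (pullback.lift_fst _ _ _)
        (pullback.lift (pullback.lift (𝟙 _) E'.κ (by rw [E'.κ_σ, Category.id_comp])) 0 ?_)
        (pullback.lift_fst _ _ _)
      · rw [Category.id_comp, ← Category.assoc]
        congr 1
        ext <;> simp [u, ι₀]
      · rw [zero_comp, ← hq.w, ← Category.assoc]
        congr 1
        ext <;> simp [u, middle]
    obtain ⟨a, ha⟩ := E.isKernel.exists_lift (pullback.snd t q ≫ pullback.fst E.ρ E'.σ) (by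
      rw [Category.assoc, ← hσ, ← pullback.condition_assoc, ht, comp_zero])
    let p : pullback t q ⟶ S := pullback.lift a (pullback.snd t q ≫ pullback.snd E.ρ E'.σ) (by
      rw [← E.ι_ρ, reassoc_of% ha, pullback.condition, Category.assoc])
    have hp : p ≫ u = pullback.snd t q := by ext <;> simp [p, u, ha]
    refine exists_fac_of_cover (pullback.fst t q) (ι₀ ≫ q)
      (p ≫ inv (pullback.fst (u ≫ q) (ι₀ ≫ q)) ≫ pullback.snd (u ≫ q) (ι₀ ≫ q)) t ?_
    rw [Category.assoc, Category.assoc, ← pullback.condition, IsIso.inv_hom_id_assoc,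
      reassoc_of% hp, pullback.condition]
  have hepi : ∀ X : C, Epi (flatMap q (𝟙 X)) := fun X => epi_flatMap q X
  let F : Butterfly H K := {
    E := Q
    κ := κ₀ ≫ q
    ι := ι₀ ≫ q
    σ := σ
    ρ := ρ
    κ_σ := by rw [Category.assoc, hσ]; simp [κ₀, E.κ_σ]
    ι_ρ := by rw [Category.assoc, hρ]; simp [ι₀, E'.ι_ρ]
    κ_ρ := by rw [Category.assoc, hρ]; simp [κ₀]
    isKernel := hιker
    isCokernel := hιker.isCokernel
    κ_equivariant := by
      have := hepi H.top
      rw [← cancel_epi (flatMap q (𝟙 H.top)), flatMap_conj, flatMap_brk, Category.comp_id,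
        Category.id_comp, ← Category.assoc, flatMap_comp, hσ, Category.comp_id]
      have h : flatMap (pullback.fst E.ρ E'.σ ≫ E.σ) (𝟙 H.top) ≫ H.action.act ≫ κ₀ =
          brk (𝟙 _) κ₀ := by
        ext
        · simp only [κ₀, brk_comp, Category.assoc, pullback.lift_fst, Category.id_comp, E.κ_brk]
        · simp only [κ₀, brk_comp, Category.assoc, pullback.lift_snd, Category.id_comp,
            comp_zero, brk_zero_right]
      simpa [brk_comp] using h =≫ q
    ι_equivariant := by
      have := hepi K.top
      rw [← cancel_epi (flatMap q (𝟙 K.top)), flatMap_conj, flatMap_brk, Category.comp_id,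
        Category.id_comp, ← Category.assoc, flatMap_comp, hρ, Category.comp_id]
      have h : flatMap (pullback.snd E.ρ E'.σ ≫ E'.ρ) (𝟙 K.top) ≫ K.action.act ≫ ι₀ =
          brk (𝟙 _) ι₀ := by
        ext
        · simp only [ι₀, brk_comp, Category.assoc, pullback.lift_fst, Category.id_comp,
            comp_zero, brk_zero_right]
        · simp only [ι₀, brk_comp, Category.assoc, pullback.lift_snd, Category.id_comp, E'.ι_brk]
      simpa [brk_comp] using h =≫ q }
  exact ⟨F, ⟨{
    q := q
    isCokernel := hq
    κ_eq := rfl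
    ι_eq := rfl
    q_σ := hσ
    q_ρ := hρ }⟩⟩

end Composition

/-! ### The calculus of elements of a composite -/

namespace Comp

variable {H G K : CrossedModule C} {E : Butterfly H G} {E' : Butterfly G K} {F : Butterfly H K}
  (D : Comp E E' F)

theorem isRegularEpi_q : IsRegularEpi D.q := D.isCokernel.isRegularEpi

theorem comp_pair {T T' : C} (t : T' ⟶ T) (x : T ⟶ E.E) (y : T ⟶ E'.E)
    (h : x ≫ E.ρ = y ≫ E'.σ) :
    t ≫ D.pair x y h = D.pair (t ≫ x) (t ≫ y) (by rw [Category.assoc, h, Category.assoc]) := by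
  rw [pair, pair, ← Category.assoc]
  congr 1
  ext <;> simp

theorem pair_congr {T : C} {x x' : T ⟶ E.E} {y y' : T ⟶ E'.E} (h : x ≫ E.ρ = y ≫ E'.σ)
    (hx : x = x') (hy : y = y') : D.pair x y h = D.pair x' y' (hx ▸ hy ▸ h) := by
  subst hx hy
  rfl

theorem hom_ext {Z : C} {f g : F.E ⟶ Z}
    (h : ∀ {T : C} (x : T ⟶ E.E) (y : T ⟶ E'.E) (hxy : x ≫ E.ρ = y ≫ E'.σ),
      D.pair x y hxy ≫ f = D.pair x y hxy ≫ g) : f = g := by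
  have := D.isRegularEpi_q
  have h' := h (pullback.fst E.ρ E'.σ) (pullback.snd E.ρ E'.σ) pullback.condition
  have e : pullback.lift (pullback.fst E.ρ E'.σ) (pullback.snd E.ρ E'.σ) pullback.condition =
    𝟙 _ := by ext <;> simp
  rw [pair, e, Category.id_comp] at h'
  rwa [cancel_epi] at h'

theorem exists_desc {Z : C} (t : pullback E.ρ E'.σ ⟶ Z) (ht : E.middle E' ≫ t = 0) :
    ∃ f : F.E ⟶ Z, ∀ {T : C} (x : T ⟶ E.E) (y : T ⟶ E'.E) (h : x ≫ E.ρ = y ≫ E'.σ),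
      D.pair x y h ≫ f = pullback.lift x y h ≫ t := by
  obtain ⟨f, hf⟩ := D.isCokernel.exists_desc t ht
  exact ⟨f, fun x y h => by rw [pair, Category.assoc, hf]⟩

/-- Every element of a composite is locally of the form `[x, y]`. -/
theorem exists_pair {T : C} (w : T ⟶ F.E) :
    ∃ (T' : C) (e : T' ⟶ T) (x : T' ⟶ E.E) (y : T' ⟶ E'.E) (h : x ≫ E.ρ = y ≫ E'.σ),
      IsRegularEpi e ∧ D.pair x y h = e ≫ w := by
  have := D.isRegularEpi_q
  refine ⟨pullback w D.q, pullback.fst _ _, pullback.snd _ _ ≫ pullback.fst _ _,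
    pullback.snd _ _ ≫ pullback.snd _ _, by simp [pullback.condition], inferInstance, ?_⟩
  refine Eq.trans ?_ pullback.condition.symm
  rw [pair]
  congr 1
  ext <;> simp

theorem pair_κ_zero {T : C} (x : T ⟶ H.top) (h) :
    D.pair (x ≫ E.κ) 0 h = x ≫ F.κ := by
  rw [D.κ_eq, pair, ← Category.assoc]
  congr 1
  ext <;> simp

theorem pair_zero_ι {T : C} (x : T ⟶ K.top) (h) :
    D.pair 0 (x ≫ E'.ι) h = x ≫ F.ι := by
  rw [D.ι_eq, pair, ← Category.assoc]
  congr 1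
  ext <;> simp

theorem pair_ι_κ {T : C} (x : T ⟶ G.top) (h) : D.pair (x ≫ E.ι) (x ≫ E'.κ) h = 0 := by
  have := x ≫= D.isCokernel.w
  rw [comp_zero, ← Category.assoc] at this
  refine Eq.trans ?_ this
  rw [pair]
  congr 1
  ext <;> simp

end Comp

/-! ### Whiskering, associators and unitors -/

theorem Butterfly.id_hom {H G : CrossedModule C} (E : Butterfly H G) :
    Butterfly.Hom.hom (𝟙 E) = 𝟙 E.E := rfl

theorem Butterfly.comp_hom {H G : CrossedModule C} {E E' E'' : Butterfly H G} (f : E ⟶ E')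
    (g : E' ⟶ E'') :
    Butterfly.Hom.hom (f ≫ g) = Butterfly.Hom.hom f ≫ Butterfly.Hom.hom g := rfl

namespace Comp

variable {H G K L : CrossedModule C}

/-- The elements `[[x, y], z]` cover a threefold composite. -/
theorem hom_ext₃ {E : Butterfly H G} {E' : Butterfly G K} {A : Butterfly H K} (D : Comp E E' A)
    {E'' : Butterfly K L} {F : Butterfly H L} (D' : Comp A E'' F) {Z : C} {f g : F.E ⟶ Z}
    (h : ∀ {T : C} (x : T ⟶ E.E) (y : T ⟶ E'.E) (z : T ⟶ E''.E) (hxy : x ≫ E.ρ = y ≫ E'.σ)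
      (h' : D.pair x y hxy ≫ A.ρ = z ≫ E''.σ),
      D'.pair (D.pair x y hxy) z h' ≫ f = D'.pair (D.pair x y hxy) z h' ≫ g) : f = g := by
  refine D'.hom_ext fun {T} w z hwz => ?_
  obtain ⟨T', e, x, y, hxy, he, hw⟩ := D.exists_pair w
  rw [← cancel_epi e, ← Category.assoc, ← Category.assoc, comp_pair,
    D'.pair_congr _ hw.symm (rfl : e ≫ z = e ≫ z)]
  exact h _ _ _ _ _

/-- The elements `[[[x, y], z], w]` cover a fourfold composite. -/
theorem hom_ext₄ {M : CrossedModule C} {E : Butterfly H G} {E' : Butterfly G K}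
    {A : Butterfly H K} (D : Comp E E' A) {E'' : Butterfly K L} {B : Butterfly H L}
    (D' : Comp A E'' B) {E''' : Butterfly L M} {F : Butterfly H M} (D'' : Comp B E''' F)
    {Z : C} {f g : F.E ⟶ Z}
    (h : ∀ {T : C} (x : T ⟶ E.E) (y : T ⟶ E'.E) (z : T ⟶ E''.E) (w : T ⟶ E'''.E)
      (hxy : x ≫ E.ρ = y ≫ E'.σ) (h' : D.pair x y hxy ≫ A.ρ = z ≫ E''.σ)
      (h'' : D'.pair (D.pair x y hxy) z h' ≫ B.ρ = w ≫ E'''.σ),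
      D''.pair (D'.pair (D.pair x y hxy) z h') w h'' ≫ f =
        D''.pair (D'.pair (D.pair x y hxy) z h') w h'' ≫ g) : f = g := by
  refine D'.hom_ext₃ D'' fun {T} u z w hu huw => ?_
  obtain ⟨T', e, x, y, hxy, he, hw⟩ := D.exists_pair u
  have h₁ : e ≫ D'.pair u z hu = D'.pair (D.pair x y hxy) (e ≫ z)
      (by rw [hw, Category.assoc, hu, Category.assoc]) := by
    rw [comp_pair, D'.pair_congr _ hw.symm (rfl : e ≫ z = e ≫ z)]
  rw [← cancel_epi e, ← Category.assoc, ← Category.assoc, comp_pair,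
    D''.pair_congr _ h₁ (rfl : e ≫ w = e ≫ w)]
  exact h _ _ _ _ _ _ _

/-- A morphism on the pullback that is compatible with the legs induces a 2-cell on the
composite. -/
theorem exists_homOfPullback {E : Butterfly H G} {E' : Butterfly G K} {F : Butterfly H K}
    (D : Comp E E' F) {F' : Butterfly H K} (t : pullback E.ρ E'.σ ⟶ F'.E)
    (ht : E.middle E' ≫ t = 0)
    (hκ : pullback.lift E.κ 0 (by rw [E.κ_ρ, zero_comp]) ≫ t = F'.κ)
    (hι : pullback.lift 0 E'.ι (by rw [E'.isKernel.w, zero_comp]) ≫ t = F'.ι)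
    (hσ : t ≫ F'.σ = pullback.fst _ _ ≫ E.σ) (hρ : t ≫ F'.ρ = pullback.snd _ _ ≫ E'.ρ) :
    ∃ f : F ⟶ F', ∀ {T : C} (x : T ⟶ E.E) (y : T ⟶ E'.E) (h : x ≫ E.ρ = y ≫ E'.σ),
      D.pair x y h ≫ Butterfly.Hom.hom f = pullback.lift x y h ≫ t := by
  obtain ⟨f, hf⟩ := D.exists_desc t ht
  refine ⟨⟨f, ?_, ?_, ?_, ?_⟩, hf⟩
  · rw [← hκ, ← hf, D.κ_eq]
    rfl
  · rw [← hι, ← hf, D.ι_eq]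
    rfl
  · refine D.hom_ext fun x y h => ?_
    rw [← Category.assoc, hf, Category.assoc, hσ, D.pair_σ, pullback.lift_fst_assoc]
  · refine D.hom_ext fun x y h => ?_
    rw [← Category.assoc, hf, Category.assoc, hρ, D.pair_ρ, pullback.lift_snd_assoc]

/-- The horizontal composite of two 2-cells, `[x, y] ↦ [f x, f' y]`. -/
theorem exists_whisker {E₁ E₂ : Butterfly H G} {E₁' E₂' : Butterfly G K} {F₁ F₂ : Butterfly H K}
    (D₁ : Comp E₁ E₁' F₁) (D₂ : Comp E₂ E₂' F₂) (f : E₁ ⟶ E₂) (f' : E₁' ⟶ E₂') :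
    ∃ φ : F₁ ⟶ F₂, ∀ {T : C} (x : T ⟶ E₁.E) (y : T ⟶ E₁'.E) (h : x ≫ E₁.ρ = y ≫ E₁'.σ),
      D₁.pair x y h ≫ Butterfly.Hom.hom φ =
        D₂.pair (x ≫ Butterfly.Hom.hom f) (y ≫ Butterfly.Hom.hom f')
          (by rw [Category.assoc, f.hom_ρ, h, Category.assoc, f'.hom_σ]) := by
  obtain ⟨φ, hφ⟩ := D₁.exists_homOfPullback (F' := F₂)
    (D₂.pair (pullback.fst _ _ ≫ Butterfly.Hom.hom f) (pullback.snd _ _ ≫ Butterfly.Hom.hom f')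
      (by rw [Category.assoc, f.hom_ρ, pullback.condition, Category.assoc, f'.hom_σ]))
    (by
      rw [comp_pair]
      refine (D₂.pair_congr _ ?_ ?_).trans (D₂.pair_ι_κ (𝟙 _) (by
        simp [E₂.ι_ρ, E₂'.κ_σ]))
      · simpa [Butterfly.middle] using f.ι_hom
      · simpa [Butterfly.middle] using f'.κ_hom)
    (by
      rw [comp_pair]
      refine (D₂.pair_congr _ ?_ ?_).trans ((D₂.pair_κ_zero (𝟙 _) (by simp [E₂.κ_ρ])).trans
        (Category.id_comp _))
      · simpa using f.κ_hom
      · simp)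
    (by
      rw [comp_pair]
      refine (D₂.pair_congr _ ?_ ?_).trans ((D₂.pair_zero_ι (𝟙 _) (by
        simp [E₂'.isKernel.w])).trans (Category.id_comp _))
      · simp
      · simpa using f'.ι_hom)
    (by rw [D₂.pair_σ, Category.assoc, f.hom_σ])
    (by rw [D₂.pair_ρ, Category.assoc, f'.hom_ρ])
  refine ⟨φ, fun x y h => ?_⟩
  rw [hφ, comp_pair]
  exact D₂.pair_congr _ (by simp) (by simp)

/-- The associator: the triples `(x, y, z)` cover both composites, and the two cokernels are taken
one after the other. -/
theorem exists_associator {E : Butterfly H G} {E' : Butterfly G K} {A : Butterfly H K}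
    (D : Comp E E' A) {E'' : Butterfly K L} {F : Butterfly H L} (D' : Comp A E'' F)
    {B : Butterfly G L} (DB : Comp E' E'' B) {F' : Butterfly H L} (DB' : Comp E B F') :
    ∃ φ : F ⟶ F', ∀ {T : C} (x : T ⟶ E.E) (y : T ⟶ E'.E) (z : T ⟶ E''.E)
      (hxy : x ≫ E.ρ = y ≫ E'.σ) (hyz : y ≫ E'.ρ = z ≫ E''.σ),
      D'.pair (D.pair x y hxy) z (by rw [D.pair_ρ, hyz]) ≫ Butterfly.Hom.hom φ =
        DB'.pair x (DB.pair y z hyz) (by rw [DB.pair_σ, hxy]) := by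
  have := D.isRegularEpi_q
  have hk := E.isKernel_middle E' D.isCokernel
  have := hk.mono
  -- `W` is the object of triples `(x, y, z)`, and `c` sends such a triple to `([x, y], z)`
  let W := pullback (pullback.snd E.ρ E'.σ ≫ E'.ρ) E''.σ
  let c : W ⟶ pullback A.ρ E''.σ := pullback.lift (pullback.fst _ _ ≫ D.q) (pullback.snd _ _)
    (by rw [Category.assoc, D.q_ρ, pullback.condition])
  have hsq : IsPullback c (pullback.fst (pullback.snd E.ρ E'.σ ≫ E'.ρ) E''.σ)
      (pullback.fst A.ρ E''.σ) D.q := by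
    refine ⟨⟨by simp [c]⟩, ⟨PullbackCone.IsLimit.mk _
      (fun s => pullback.lift s.snd (s.fst ≫ pullback.snd _ _) ?_) ?_ ?_ ?_⟩⟩
    · rw [← D.q_ρ, ← reassoc_of% s.condition, pullback.condition, Category.assoc]
    · intro s
      have := s.condition
      ext <;> simp [c, this]
    · intro s
      simp
    · intro s m h₁ h₂
      refine pullback.hom_ext ?_ ?_
      · simp [h₂]
      · simp [← h₁, c]
  have hc : IsRegularEpi c :=
    (Regular.regularEpiIsStableUnderBaseChange (C := C)).of_isPullback hsq.flip
      (by simpa using D.isRegularEpi_q)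
  let k : G.top ⟶ W := pullback.lift (E.middle E') 0 (by simp [Butterfly.middle, E'.κ_ρ])
  have hkc : IsCokernel k c := by
    have : Mono k := by
      have : Mono (k ≫ pullback.fst _ _) := by
        rw [pullback.lift_fst]; infer_instance
      exact mono_of_mono _ (pullback.fst _ _)
    have : IsKernel k c := by
      refine IsKernel.of_exists_lift ?_ fun {T} t ht => ?_
      · ext
        · simp [k, c, hk.w]
        · simp [k, c]
      · obtain ⟨a, ha⟩ := hk.exists_lift (t ≫ pullback.fst _ _) (by
          simpa [c] using ht =≫ pullback.fst _ _)
        refine ⟨a, ?_⟩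
        ext1
        · simp [k, ha]
        · simpa [k, c] using (ht =≫ pullback.snd _ _).symm
    exact this.isCokernel
  -- the morphism `(x, y, z) ↦ [x, [y, z]]`, which factors through the cokernel `c`
  let t₀ : W ⟶ F'.E := DB'.pair (pullback.fst _ _ ≫ pullback.fst _ _)
    (DB.pair (pullback.fst _ _ ≫ pullback.snd _ _) (pullback.snd _ _)
      (by rw [Category.assoc, pullback.condition]))
    (by rw [DB.pair_σ, Category.assoc, Category.assoc, pullback.condition])
  have h₀ : ∀ {T : C} (x : T ⟶ E.E) (y : T ⟶ E'.E) (z : T ⟶ E''.E)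
      (hxy : x ≫ E.ρ = y ≫ E'.σ) (hyz : y ≫ E'.ρ = z ≫ E''.σ),
      pullback.lift (pullback.lift x y hxy) z (by rw [pullback.lift_snd_assoc, hyz]) ≫ t₀ =
        DB'.pair x (DB.pair y z hyz) (by rw [DB.pair_σ, hxy]) := by
    intro T x y z hxy hyz
    simp only [t₀]
    rw [comp_pair]
    refine DB'.pair_congr _ (by simp) ?_
    rw [comp_pair]
    exact DB.pair_congr _ (by simp) (by simp)
  have pair_zero : DB.pair (0 : H.top ⟶ _) 0 (by simp) = 0 := by
    simpa using DB.pair_ι_κ (0 : H.top ⟶ _) (by simp)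
  obtain ⟨t, ht⟩ := hkc.exists_desc t₀ (by
    simp only [k, Butterfly.middle]
    rw [h₀ _ _ _ (by rw [E.ι_ρ, E'.κ_σ]) (by simp [E'.κ_ρ])]
    refine (DB'.pair_congr _ ?_ ?_).trans (DB'.pair_ι_κ (𝟙 _) (by simp [E.ι_ρ, B.κ_σ]))
    · simp
    · simpa using DB.pair_κ_zero (𝟙 _) (by simp [E'.κ_ρ]))
  have h₁ : ∀ {T : C} (w : T ⟶ A.E) (x : T ⟶ E.E) (y : T ⟶ E'.E) (z : T ⟶ E''.E)
      (hxy : x ≫ E.ρ = y ≫ E'.σ) (hyz : y ≫ E'.ρ = z ≫ E''.σ) (hw : w ≫ A.ρ = z ≫ E''.σ),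
      w = D.pair x y hxy → pullback.lift w z hw ≫ t =
        DB'.pair x (DB.pair y z hyz) (by rw [DB.pair_σ, hxy]) := by
    rintro T _ x y z hxy hyz hw rfl
    rw [← h₀ x y z hxy hyz, ← ht, ← Category.assoc]
    congr 1
    ext <;> simp [c, pair]
  refine Exists.elim (D'.exists_homOfPullback (F' := F') t ?_ ?_ ?_ ?_ ?_) fun φ hφ => ?_
  · refine (h₁ A.ι 0 E'.ι E''.κ (by simp [E'.isKernel.w]) (by rw [E'.ι_ρ, E''.κ_σ]) _ ?_).trans ?_
    · simpa using (D.pair_zero_ι (𝟙 _) (by simp [E'.isKernel.w])).symm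
    · refine (DB'.pair_congr _ ?_ ?_).trans (DB'.pair_ι_κ 0 (by simp))
      · simp
      · simpa using DB.pair_ι_κ (𝟙 _) (by simp [E'.ι_ρ, E''.κ_σ])
  · refine (h₁ A.κ E.κ 0 0 (by simp [E.κ_ρ]) (by simp) _ ?_).trans ?_
    · simpa using (D.pair_κ_zero (𝟙 _) (by simp [E.κ_ρ])).symm
    · refine (DB'.pair_congr _ ?_ ?_).trans ((DB'.pair_κ_zero (𝟙 _) (by simp [E.κ_ρ])).trans
        (Category.id_comp _))
      · simp
      · exact pair_zero
  · refine (h₁ 0 0 0 E''.ι (by simp) (by simp [E''.isKernel.w]) _ ?_).trans ?_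
    · simpa using (D.pair_ι_κ (0 : L.top ⟶ _) (by simp)).symm
    · refine (DB'.pair_congr _ ?_ ?_).trans ((DB'.pair_zero_ι (𝟙 _) (by
        simp [B.isKernel.w])).trans (Category.id_comp _))
      · rfl
      · simpa using DB.pair_zero_ι (𝟙 _) (by simp [E''.isKernel.w])
  · have := hkc.epi
    rw [← cancel_epi c, ← Category.assoc, ht, DB'.pair_σ]
    simp [c, D.q_σ]
  · have := hkc.epi
    rw [← cancel_epi c, ← Category.assoc, ht, DB'.pair_ρ, DB.pair_ρ]
    simp [c]
  · refine ⟨φ, fun x y z hxy hyz => ?_⟩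
    rw [hφ, h₁ _ x y z hxy hyz _ rfl]

end Comp

/-- The composite `g a ∘ (g b)⁻¹` in the groupoid of a crossed module. -/
noncomputable def Ident.mul {G : CrossedModule C} {I : Butterfly G G} (J : Ident I) :
    G.top ⨯ G.top ⟶ I.E :=
  pullback.lift (prod.fst ≫ I.ι) (prod.snd ≫ I.κ) (by
    rw [Category.assoc, I.isKernel.w, Category.assoc, I.κ_ρ, comp_zero, comp_zero]) ≫
    J.groupoid.m

theorem Ident.comp_mul {G : CrossedModule C} {I : Butterfly G G} (J : Ident I) {T : C}
    (a b : T ⟶ G.top) : prod.lift a b ≫ J.mul = pullback.lift (a ≫ I.ι) (b ≫ I.κ) (by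
      rw [Category.assoc, I.isKernel.w, Category.assoc, I.κ_ρ, comp_zero, comp_zero]) ≫
      J.groupoid.m := by
  rw [mul, ← Category.assoc]
  congr 1
  ext <;> simp

theorem Ident.left_mul {G : CrossedModule C} {I : Butterfly G G} (J : Ident I) :
    prod.lift (𝟙 _) 0 ≫ J.mul = I.ι := by
  rw [J.comp_mul]
  refine (J.groupoid.lift_m_left _ _ _ ?_).trans ?_ <;> simp [reassoc_of% I.isKernel.w]

theorem Ident.right_mul {G : CrossedModule C} {I : Butterfly G G} (J : Ident I) :
    prod.lift 0 (𝟙 _) ≫ J.mul = I.κ := by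
  rw [J.comp_mul]
  refine (J.groupoid.lift_m_right _ _ _ ?_).trans ?_ <;> simp [reassoc_of% I.κ_ρ]

theorem Ident.diag_mul {G : CrossedModule C} {I : Butterfly G G} (J : Ident I) :
    prod.lift (𝟙 _) (𝟙 _) ≫ J.mul = G.bd ≫ J.e := by
  rw [J.comp_mul, J.groupoid.lift_m_inv _ _ _ (by rw [J.κ_eq, Category.assoc]),
    Category.id_comp, reassoc_of% I.ι_ρ]

theorem Ident.mul_ρ {G : CrossedModule C} {I : Butterfly G G} (J : Ident I) :
    J.mul ≫ I.ρ = prod.fst ≫ G.bd := by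
  rw [mul, Category.assoc, J.groupoid.m_d, pullback.lift_fst_assoc, Category.assoc, I.ι_ρ]

theorem Ident.mul_σ {G : CrossedModule C} {I : Butterfly G G} (J : Ident I) :
    J.mul ≫ I.σ = prod.snd ≫ G.bd := by
  rw [mul, Category.assoc, J.groupoid.m_c, pullback.lift_snd_assoc, Category.assoc, I.κ_σ]

/-- The inverse `x ↦ [e (σ x), x]` of the left unitor. -/
noncomputable def Ident.leftInv {H G : CrossedModule C} {I : Butterfly H H} (J : Ident I)
    {E F : Butterfly H G} (D : Comp I E F) : E ⟶ F where
  hom := D.pair (E.σ ≫ J.e) (𝟙 E.E) (by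
    rw [Category.assoc, J.groupoid.e_d, Category.comp_id, Category.id_comp])
  κ_hom := by
    -- `(a, b) ↦ [g a ∘ (g b)⁻¹, κ a]` depends on `b` only
    have key : D.pair J.mul (prod.fst ≫ E.κ) (by rw [J.mul_ρ, Category.assoc, E.κ_σ]) =
        prod.snd ≫ F.κ := by
      apply prod_hom_ext
      · rw [D.comp_pair, prod.lift_snd_assoc, zero_comp]
        exact (D.pair_congr _ (by simp [J.left_mul]) (by simp)).trans
          (D.pair_ι_κ (𝟙 _) (by simp [I.ι_ρ, E.κ_σ]))
      · rw [D.comp_pair, prod.lift_snd_assoc, Category.id_comp]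
        exact (D.pair_congr _ (by simp [J.right_mul]) (by simp)).trans
          ((D.pair_κ_zero (𝟙 _) (by simp [I.κ_ρ])).trans (Category.id_comp _))
    have h := prod.lift (𝟙 _) (𝟙 _) ≫= key
    rw [prod.lift_snd_assoc, Category.id_comp, D.comp_pair] at h
    rw [← h, D.comp_pair]
    exact D.pair_congr _ (by rw [J.diag_mul, reassoc_of% E.κ_σ]) (by simp)
  ι_hom := by
    rw [D.comp_pair]
    exact (D.pair_congr _ (by simp [reassoc_of% E.isKernel.w]) (by simp)).trans
      ((D.pair_zero_ι (𝟙 _) (by simp [E.isKernel.w])).trans (Category.id_comp _))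
  hom_σ := by
    rw [D.pair_σ, Category.assoc, J.groupoid.e_c, Category.comp_id]
  hom_ρ := by
    rw [D.pair_ρ, Category.id_comp]

/-- The inverse `x ↦ [x, e (ρ x)]` of the right unitor. -/
noncomputable def Ident.rightInv {H G : CrossedModule C} {I : Butterfly G G} (J : Ident I)
    {E F : Butterfly H G} (D : Comp E I F) : E ⟶ F where
  hom := D.pair (𝟙 E.E) (E.ρ ≫ J.e) (by
    rw [Category.assoc, J.groupoid.e_c, Category.comp_id, Category.id_comp])
  κ_hom := by
    rw [D.comp_pair]
    exact (D.pair_congr _ (by simp) (by simp [reassoc_of% E.κ_ρ])).trans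
      ((D.pair_κ_zero (𝟙 _) (by simp [E.κ_ρ])).trans (Category.id_comp _))
  ι_hom := by
    -- `(a, b) ↦ [ι b, g a ∘ (g b)⁻¹]` depends on `a` only
    have key : D.pair (prod.snd ≫ E.ι) J.mul (by rw [J.mul_σ, Category.assoc, E.ι_ρ]) =
        prod.fst ≫ F.ι := by
      apply prod_hom_ext
      · rw [D.comp_pair, prod.lift_fst_assoc, Category.id_comp]
        exact (D.pair_congr _ (by simp) (by simp [J.left_mul])).trans
          ((D.pair_zero_ι (𝟙 _) (by simp [I.isKernel.w])).trans (Category.id_comp _))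
      · rw [D.comp_pair, prod.lift_fst_assoc, zero_comp]
        exact (D.pair_congr _ (by simp) (by simp [J.right_mul])).trans
          (D.pair_ι_κ (𝟙 _) (by simp [E.ι_ρ, I.κ_σ]))
    have h := prod.lift (𝟙 _) (𝟙 _) ≫= key
    rw [prod.lift_fst_assoc, Category.id_comp, D.comp_pair] at h
    rw [← h, D.comp_pair]
    exact D.pair_congr _ (by simp) (by rw [J.diag_mul, reassoc_of% E.ι_ρ])
  hom_σ := by
    rw [D.pair_σ, Category.id_comp]
  hom_ρ := by
    rw [D.pair_ρ, Category.assoc, J.groupoid.e_d, Category.comp_id]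

/-! ### The bicategory of butterflies -/

namespace Butterfly

variable {H G K L M : CrossedModule C}

/-- A chosen composite of two butterflies. -/
noncomputable def comp (E : Butterfly H G) (E' : Butterfly G K) : Butterfly H K :=
  (E.exists_comp E').choose

/-- The chosen composite is a composite. -/
noncomputable def compD (E : Butterfly H G) (E' : Butterfly G K) : Comp E E' (E.comp E') :=
  (E.exists_comp E').choose_spec.some

/-- The identity butterfly of a crossed module. -/
noncomputable def one (hHS : HuqImpliesSmith C) (G : CrossedModule C) : Butterfly G G :=
  (G.exists_ident hHS).choose

/-- The structure of the identity butterfly. -/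
noncomputable def oneJ (hHS : HuqImpliesSmith C) (G : CrossedModule C) : Ident (one hHS G) :=
  (G.exists_ident hHS).choose_spec.some

/-- Left whiskering, `[x, y] ↦ [x, f y]`. -/
noncomputable def whiskerLeft (E : Butterfly H G) {E₁ E₂ : Butterfly G K} (f : E₁ ⟶ E₂) :
    E.comp E₁ ⟶ E.comp E₂ :=
  ((E.compD E₁).exists_whisker (E.compD E₂) (𝟙 E) f).choose

/-- Right whiskering, `[x, y] ↦ [f x, y]`. -/
noncomputable def whiskerRight {E₁ E₂ : Butterfly H G} (f : E₁ ⟶ E₂) (E : Butterfly G K) :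
    E₁.comp E ⟶ E₂.comp E :=
  ((E₁.compD E).exists_whisker (E₂.compD E) f (𝟙 E)).choose

/-- The associator, `[[x, y], z] ↦ [x, [y, z]]`. -/
noncomputable def associator (E : Butterfly H G) (E' : Butterfly G K) (E'' : Butterfly K L) :
    (E.comp E').comp E'' ≅ E.comp (E'.comp E'') :=
  ((E.compD E').exists_associator ((E.comp E').compD E'') (E'.compD E'')
    (E.compD (E'.comp E''))).choose.iso

/-- The left unitor, `[e (σ x), x] ↦ x`. -/
noncomputable def leftUnitor (hHS : HuqImpliesSmith C) (E : Butterfly H G) :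
    (one hHS H).comp E ≅ E :=
  ((oneJ hHS H).leftInv ((one hHS H).compD E)).iso.symm

/-- The right unitor, `[x, e (ρ x)] ↦ x`. -/
noncomputable def rightUnitor (hHS : HuqImpliesSmith C) (E : Butterfly H G) :
    E.comp (one hHS G) ≅ E :=
  ((oneJ hHS G).rightInv (E.compD (one hHS G))).iso.symm

section

variable {T : C}

theorem pair_whiskerLeft (E : Butterfly H G) {E₁ E₂ : Butterfly G K} (f : E₁ ⟶ E₂)
    (x : T ⟶ E.E) (y : T ⟶ E₁.E) (h : x ≫ E.ρ = y ≫ E₁.σ) :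
    (E.compD E₁).pair x y h ≫ (E.whiskerLeft f).hom =
      (E.compD E₂).pair x (y ≫ f.hom) (by rw [h, Category.assoc, f.hom_σ]) :=
  (((E.compD E₁).exists_whisker (E.compD E₂) (𝟙 E) f).choose_spec x y h).trans
    ((E.compD E₂).pair_congr _ (Category.comp_id _) rfl)

theorem pair_whiskerRight {E₁ E₂ : Butterfly H G} (f : E₁ ⟶ E₂) (E : Butterfly G K)
    (x : T ⟶ E₁.E) (y : T ⟶ E.E) (h : x ≫ E₁.ρ = y ≫ E.σ) :
    (E₁.compD E).pair x y h ≫ (whiskerRight f E).hom =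
      (E₂.compD E).pair (x ≫ f.hom) y (by rw [← h, Category.assoc, f.hom_ρ]) :=
  (((E₁.compD E).exists_whisker (E₂.compD E) f (𝟙 E)).choose_spec x y h).trans
    ((E₂.compD E).pair_congr _ rfl (Category.comp_id _))

theorem pair_associator (E : Butterfly H G) (E' : Butterfly G K) (E'' : Butterfly K L)
    (x : T ⟶ E.E) (y : T ⟶ E'.E) (z : T ⟶ E''.E) (hxy : x ≫ E.ρ = y ≫ E'.σ)
    (h : (E.compD E').pair x y hxy ≫ (E.comp E').ρ = z ≫ E''.σ) :
    ((E.comp E').compD E'').pair ((E.compD E').pair x y hxy) z h ≫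
        (associator E E' E'').hom.hom =
      (E.compD (E'.comp E'')).pair x ((E'.compD E'').pair y z (by rw [← h, Comp.pair_ρ]))
        (by rw [Comp.pair_σ, hxy]) :=
  ((E.compD E').exists_associator ((E.comp E').compD E'') (E'.compD E'')
    (E.compD (E'.comp E''))).choose_spec x y z hxy (by rw [← h, Comp.pair_ρ])

variable (hHS : HuqImpliesSmith C)

theorem leftUnitor_inv_hom (E : Butterfly H G) : (leftUnitor hHS E).inv.hom =
    ((one hHS H).compD E).pair (E.σ ≫ (oneJ hHS H).e) (𝟙 E.E)
      (by rw [Category.assoc, (oneJ hHS H).groupoid.e_d, Category.comp_id, Category.id_comp]) :=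
  rfl

theorem rightUnitor_inv_hom (E : Butterfly H G) : (rightUnitor hHS E).inv.hom =
    (E.compD (one hHS G)).pair (𝟙 E.E) (E.ρ ≫ (oneJ hHS G).e)
      (by rw [Category.assoc, (oneJ hHS G).groupoid.e_c, Category.comp_id, Category.id_comp]) :=
  rfl

theorem pair_leftUnitor (E : Butterfly H G) (u : T ⟶ (one hHS H).E) (x : T ⟶ E.E)
    (h : u ≫ (one hHS H).ρ = x ≫ E.σ) (hu : u = x ≫ E.σ ≫ (oneJ hHS H).e) :
    ((one hHS H).compD E).pair u x h ≫ (leftUnitor hHS E).hom.hom = x := by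
  have h₁ : ((one hHS H).compD E).pair u x h = x ≫ (leftUnitor hHS E).inv.hom := by
    rw [leftUnitor_inv_hom, Comp.comp_pair]
    exact Comp.pair_congr _ _ hu (Category.comp_id _).symm
  have h₂ := congrArg Butterfly.Hom.hom (leftUnitor hHS E).inv_hom_id
  rw [comp_hom, id_hom] at h₂
  rw [h₁, Category.assoc, h₂, Category.comp_id]

theorem pair_rightUnitor (E : Butterfly H G) (x : T ⟶ E.E) (u : T ⟶ (one hHS G).E)
    (h : x ≫ E.ρ = u ≫ (one hHS G).σ) (hu : u = x ≫ E.ρ ≫ (oneJ hHS G).e) :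
    (E.compD (one hHS G)).pair x u h ≫ (rightUnitor hHS E).hom.hom = x := by
  have h₁ : (E.compD (one hHS G)).pair x u h = x ≫ (rightUnitor hHS E).inv.hom := by
    rw [rightUnitor_inv_hom, Comp.comp_pair]
    exact Comp.pair_congr _ _ (Category.comp_id _).symm hu
  have h₂ := congrArg Butterfly.Hom.hom (rightUnitor hHS E).inv_hom_id
  rw [comp_hom, id_hom] at h₂
  rw [h₁, Category.assoc, h₂, Category.comp_id]

theorem pair_whiskerLeft_assoc (E : Butterfly H G) {E₁ E₂ : Butterfly G K} (f : E₁ ⟶ E₂)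
    (x : T ⟶ E.E) (y : T ⟶ E₁.E) (h : x ≫ E.ρ = y ≫ E₁.σ) {Z : C}
    (k : (E.comp E₂).E ⟶ Z) :
    (E.compD E₁).pair x y h ≫ (E.whiskerLeft f).hom ≫ k =
      (E.compD E₂).pair x (y ≫ f.hom) (by rw [h, Category.assoc, f.hom_σ]) ≫ k := by
  rw [← Category.assoc, pair_whiskerLeft]

theorem pair_whiskerRight_assoc {E₁ E₂ : Butterfly H G} (f : E₁ ⟶ E₂) (E : Butterfly G K)
    (x : T ⟶ E₁.E) (y : T ⟶ E.E) (h : x ≫ E₁.ρ = y ≫ E.σ) {Z : C}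
    (k : (E₂.comp E).E ⟶ Z) :
    (E₁.compD E).pair x y h ≫ (whiskerRight f E).hom ≫ k =
      (E₂.compD E).pair (x ≫ f.hom) y (by rw [← h, Category.assoc, f.hom_ρ]) ≫ k := by
  rw [← Category.assoc, pair_whiskerRight]

theorem pair_associator_assoc (E : Butterfly H G) (E' : Butterfly G K) (E'' : Butterfly K L)
    (x : T ⟶ E.E) (y : T ⟶ E'.E) (z : T ⟶ E''.E) (hxy : x ≫ E.ρ = y ≫ E'.σ)
    (h : (E.compD E').pair x y hxy ≫ (E.comp E').ρ = z ≫ E''.σ) {Z : C}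
    (k : (E.comp (E'.comp E'')).E ⟶ Z) :
    ((E.comp E').compD E'').pair ((E.compD E').pair x y hxy) z h ≫
        (associator E E' E'').hom.hom ≫ k =
      (E.compD (E'.comp E'')).pair x ((E'.compD E'').pair y z (by rw [← h, Comp.pair_ρ]))
        (by rw [Comp.pair_σ, hxy]) ≫ k := by
  rw [← Category.assoc, pair_associator]

end

attribute [local simp] comp_hom id_hom pair_whiskerLeft pair_whiskerRight pair_associator
  pair_whiskerLeft_assoc pair_whiskerRight_assoc pair_associator_assoc

theorem whiskerRight_comp' {E₁ E₂ E₃ : Butterfly H G} (f : E₁ ⟶ E₂) (g : E₂ ⟶ E₃)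
    (E : Butterfly G K) :
    whiskerRight (f ≫ g) E = whiskerRight f E ≫ whiskerRight g E :=
  Butterfly.Hom.ext <| (compD _ _).hom_ext fun x y h => by simp

theorem id_whiskerRight (E : Butterfly H G) (E' : Butterfly G K) :
    whiskerRight (𝟙 E) E' = 𝟙 (E.comp E') :=
  Butterfly.Hom.ext <| (compD _ _).hom_ext fun x y h => by simp

/-- The triangle law is checked after the invertible whiskering of `x ↦ [x, e (ρ x)]`, where it
reads `[x, y] ↦ [[x, e (ρ x)], y] ↦ [x, [e (σ y), y]] ↦ [x, y]`. -/
theorem triangle (hHS : HuqImpliesSmith C) (E : Butterfly H G) (E' : Butterfly G K) :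
    (associator E (one hHS G) E').hom ≫ whiskerLeft E (leftUnitor hHS E').hom =
      whiskerRight (rightUnitor hHS E).hom E' := by
  have key : whiskerRight (rightUnitor hHS E).inv E' ≫ (associator E (one hHS G) E').hom ≫
      whiskerLeft E (leftUnitor hHS E').hom = 𝟙 (E.comp E') := by
    refine Butterfly.Hom.ext <| (compD _ _).hom_ext fun x y h => ?_
    have h₁ : x ≫ (rightUnitor hHS E).inv.hom = (E.compD (one hHS G)).pair x
        (x ≫ E.ρ ≫ (oneJ hHS G).e) (by
          rw [Category.assoc, Category.assoc, (oneJ hHS G).groupoid.e_c, Category.comp_id]) := by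
      rw [rightUnitor_inv_hom, Comp.comp_pair]
      exact Comp.pair_congr _ _ (Category.comp_id _) rfl
    simp only [comp_hom, id_hom, pair_whiskerRight_assoc, h₁, pair_associator_assoc,
      pair_whiskerLeft, Category.comp_id]
    exact Comp.pair_congr _ _ rfl (pair_leftUnitor hHS E' _ _ _ (by rw [reassoc_of% h]))
  rw [← Category.id_comp (associator E (one hHS G) E').hom, ← id_whiskerRight,
    ← (rightUnitor hHS E).hom_inv_id, whiskerRight_comp', Category.assoc, Category.assoc, key,
    Category.comp_id]

/-- The bicategory of crossed modules, butterflies and morphisms of butterflies. The laws are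
equalities of morphisms out of composites, hence are checked on elements `[x, y]`, `[[x, y], z]`
and `[[[x, y], z], w]`. -/
noncomputable def bicategory (hHS : HuqImpliesSmith C) :
    BicategoryOn (O := CrossedModule C) Butterfly where
  one := one hHS
  comp := comp
  whiskerLeft := whiskerLeft
  whiskerRight := whiskerRight
  associator := associator
  leftUnitor := leftUnitor hHS
  rightUnitor := rightUnitor hHS
  whiskerLeft_id E E' := Butterfly.Hom.ext <| (compD _ _).hom_ext fun x y h => by simp
  whiskerLeft_comp E _ _ _ f g :=
    Butterfly.Hom.ext <| (compD _ _).hom_ext fun x y h => by simp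
  id_whiskerLeft f := by
    rw [← Iso.inv_comp_eq]
    refine Butterfly.Hom.ext ?_
    simp only [comp_hom, leftUnitor_inv_hom, pair_whiskerLeft, Comp.comp_pair]
    exact Comp.pair_congr _ _ (by rw [← Category.assoc, f.hom_σ]) (by simp)
  comp_whiskerLeft E E' _ _ f := by
    rw [← Category.assoc, Iso.eq_comp_inv]
    exact Butterfly.Hom.ext <| (compD _ _).hom_ext₃ (compD _ _) fun x y z _ _ => by simp
  id_whiskerRight := id_whiskerRight
  comp_whiskerRight := whiskerRight_comp'
  whiskerRight_id f := by
    rw [← Iso.inv_comp_eq]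
    refine Butterfly.Hom.ext ?_
    simp only [comp_hom, rightUnitor_inv_hom, pair_whiskerRight, Comp.comp_pair]
    exact Comp.pair_congr _ _ (by simp) (by rw [← Category.assoc, f.hom_ρ])
  whiskerRight_comp f E' E'' := by
    rw [Iso.eq_inv_comp]
    exact Butterfly.Hom.ext <| (compD _ _).hom_ext₃ (compD _ _) fun x y z _ _ => by simp
  whisker_assoc E _ _ f E'' := by
    rw [← Category.assoc, Iso.eq_comp_inv]
    exact Butterfly.Hom.ext <| (compD _ _).hom_ext₃ (compD _ _) fun x y z _ _ => by simp
  whisker_exchange f g :=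
    Butterfly.Hom.ext <| (compD _ _).hom_ext fun x y h => by simp
  pentagon E₁ E₂ E₃ E₄ := Butterfly.Hom.ext <|
    (compD _ _).hom_ext₄ (compD _ _) (compD _ _) fun x y z w _ _ _ => by simp
  triangle := triangle hHS

end Butterfly

end SemiAb

theorem mainTheorem2 {C : Type u} [Category.{v} C] [HasZeroMorphisms C] [SemiAb.SemiAbelian C]
    (hHS : SemiAb.HuqImpliesSmith C) :
    -- 2-cells are invertible
    (∀ {H G : SemiAb.CrossedModule C} {E E' : SemiAb.Butterfly H G} (f : E ⟶ E'), IsIso f) ∧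
    -- a bicategory of crossed modules, butterflies and morphisms of butterflies
    ∃ 𝓑 : SemiAb.BicategoryOn (O := SemiAb.CrossedModule C) SemiAb.Butterfly,
    -- identities are the canonical butterflies, composition is pullback followed by cokernel
    ∃ (J : ∀ G : SemiAb.CrossedModule C, SemiAb.Ident (𝓑.one G))
      (D : ∀ {H G K : SemiAb.CrossedModule C} (E : SemiAb.Butterfly H G)
        (E' : SemiAb.Butterfly G K), SemiAb.Comp E E' (𝓑.comp E E')),
    -- horizontal composition of 2-cells is induced by the universal properties
    (∀ {H G K : SemiAb.CrossedModule C} (E : SemiAb.Butterfly H G)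
      {E₁ E₂ : SemiAb.Butterfly G K} (f : E₁ ⟶ E₂) {T : C} (x : T ⟶ E.E) (y : T ⟶ E₁.E)
      (h : x ≫ E.ρ = y ≫ E₁.σ),
      (D E E₁).pair x y h ≫ (𝓑.whiskerLeft E f).hom =
        (D E E₂).pair x (y ≫ f.hom) (by rw [h, Category.assoc, f.hom_σ])) ∧
    (∀ {H G K : SemiAb.CrossedModule C} {E₁ E₂ : SemiAb.Butterfly H G} (f : E₁ ⟶ E₂)
      (E' : SemiAb.Butterfly G K) {T : C} (x : T ⟶ E₁.E) (y : T ⟶ E'.E)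
      (h : x ≫ E₁.ρ = y ≫ E'.σ),
      (D E₁ E').pair x y h ≫ (𝓑.whiskerRight f E').hom =
        (D E₂ E').pair (x ≫ f.hom) y (by rw [← h, Category.assoc, f.hom_ρ])) ∧
    -- the associators are the canonical ones, `[[x, y], z] ↦ [x, [y, z]]`
    (∀ {H G K L : SemiAb.CrossedModule C} (E : SemiAb.Butterfly H G)
      (E' : SemiAb.Butterfly G K) (E'' : SemiAb.Butterfly K L) {T : C}
      (x : T ⟶ E.E) (y : T ⟶ E'.E) (z : T ⟶ E''.E)
      (hxy : x ≫ E.ρ = y ≫ E'.σ) (hyz : y ≫ E'.ρ = z ≫ E''.σ),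
      (D (𝓑.comp E E') E'').pair ((D E E').pair x y hxy) z (by rw [SemiAb.Comp.pair_ρ, hyz]) ≫
          (𝓑.associator E E' E'').hom.hom =
        (D E (𝓑.comp E' E'')).pair x ((D E' E'').pair y z hyz)
          (by rw [SemiAb.Comp.pair_σ, hxy])) ∧
    -- the unitors are the canonical ones, `[e (σ x), x] ↦ x` and `[x, e (ρ x)] ↦ x`
    (∀ {H G : SemiAb.CrossedModule C} (E : SemiAb.Butterfly H G),
      (D (𝓑.one H) E).pair (E.σ ≫ (J H).e) (𝟙 E.E)
          (by rw [Category.assoc, (J H).groupoid.e_d, Category.comp_id, Category.id_comp]) ≫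
        (𝓑.leftUnitor E).hom.hom = 𝟙 E.E) ∧
    (∀ {H G : SemiAb.CrossedModule C} (E : SemiAb.Butterfly H G),
      (D E (𝓑.one G)).pair (𝟙 E.E) (E.ρ ≫ (J G).e)
          (by rw [Category.assoc, (J G).groupoid.e_c, Category.comp_id, Category.id_comp]) ≫
        (𝓑.rightUnitor E).hom.hom = 𝟙 E.E) := by
  refine ⟨fun f => (SemiAb.Butterfly.Hom.iso f).isIso_hom, SemiAb.Butterfly.bicategory hHS,
    SemiAb.Butterfly.oneJ hHS, SemiAb.Butterfly.compD, ?_, ?_, ?_, ?_, ?_⟩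
  · intro H G K E E₁ E₂ f T x y h
    exact SemiAb.Butterfly.pair_whiskerLeft E f x y h
  · intro H G K E₁ E₂ f E' T x y h
    exact SemiAb.Butterfly.pair_whiskerRight f E' x y h
  · intro H G K L E E' E'' T x y z hxy hyz
    exact SemiAb.Butterfly.pair_associator E E' E'' x y z hxy _
  · intro H G E
    exact SemiAb.Butterfly.pair_leftUnitor hHS E _ _ _ (Category.id_comp _).symm
  · intro H G E
    exact SemiAb.Butterfly.pair_rightUnitor hHS E _ _ _ (Category.id_comp _).symm
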